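/- Let $q\ge 2$, $R\ge 1$ and $2\le s\le C$ be integers. An orthogonal array $\mathrm{OA}(R,C,q,s)$ is a matrix $A\in\{0,\dots,q-1\}^{R\times C}$ such that, in the $R\times s$ submatrix formed by any $s$ of its columns, all $q^s$ possible rows appear the same number of times. Rao's lower bound for the number of rows is $$\rho(C,q,s)=\sum_{i=0}^{\lfloor s/2\rfloor}\binom{C}{i}(q-1)^i .$$ A family of arrays with $q,s$ fixed and parameters $(R_n,C_n)$, $C_n\to\infty$, is said to attain Rao's bound asymptotically if $R_n=\Theta(\rho(C_n,q,s))$ as $n\to\infty$. Orthogonal arrays with the following parameters exist. (1) For every prime power $q$ and integer $n\ge 2$: $\mathrm{OA}\left(q^n,\frac{q^n-1}{q-1},q,2\right)$, having $R=1+(q-1)C$, which equals Rao's bound exactly. (2) For every prime power $q$ and integer $n\ge 1$: $\mathrm{OA}(q^{3n+1},q^{2n},q,3)$, having $R=qC^{3/2}$; for no $q$ does this family attain Rao's bound asymptotically. (3) Binary arrays ($q=2$), all of which attain Rao's bound asymptotically: (a) for every even $s\ge 2$ and every $n\ge 1$ with $s\le 2^n-1$: $\mathrm{OA}(2^{n\lfloor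 s/2\rfloor},2^n-1,2,s)$, having $R=(C+1)^{\lfloor s/2\rfloor}$; (b) for every odd $s\ge 3$ and every $n\ge 1$ with $s\le 2^n$: $\mathrm{OA}(2^{1+n\lfloor s/2\rfloor},2^n,2,s)$, having $R=2C^{\lfloor s/2\rfloor}$; (c) for $s=5$ and every even $n\ge 4$: $\mathrm{OA}(2^{2n},2^n,2,5)$, having $R=C^{\lfloor s/2\rfloor}=C^2$; (d) for $s=7$ and every even $n\ge 4$: $\mathrm{OA}(2^{3n-1},2^n,2,7)$, having $R=\frac12C^{\lfloor s/2\rfloor}=\frac12C^3$. (4) Ternary arrays ($q=3$): (a) for $s=3$ and every $n\ge 1$: $\mathrm{OA}(3^{4n+1},20^n,3,3)$, having $R=3C^{4\log 3/\log 20}$; $\mathrm{OA}(3^{5n+1},45^n,3,3)$, having $R=3C^{5\log 3/\log 45}$; and $\mathrm{OA}(3^{6n+1},112^n,3,3)$, having $R=3C^{6\log 3/\log 112}$. The three exponents are $1.467$, $1.443$ and $1.397$, respectively, up to an error of at most $0.0005$, and none of these three families attains Rao's bound asymptotically; (b) for $s=4$ and every $n\ge 2$: $\mathrm{OA}(3^{2n+1},3^n,3,4)$,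 having $R=3C^2$; this family attains Rao's bound asymptotically. (5) For every prime $q$, every $s\ge 2$ and every $n\ge 1$ with $s\le q^n$: $\mathrm{OA}(q^{ns},q^n,q,s)$, having $R=C^s$; for no such $q$ and $s$ does this family attain Rao's bound asymptotically. -/

import Mathlib

/-- `IsOrthogonalArray A s`: the `R × C` matrix `A` with entries in `{0, …, q - 1}` is a `q`-ary
orthogonal array of strength `s`. Here `R ≥ 1`, `q ≥ 2` and `2 ≤ s ≤ C`, and in the `R × s` submatrix
formed by any `s` (distinct) columns, any two of the `q ^ s` possible rows occur equally often. -/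
def IsOrthogonalArray {R C q : ℕ} (A : Matrix (Fin R) (Fin C) (Fin q)) (s : ℕ) : Prop :=
  1 ≤ R ∧ 2 ≤ q ∧ 2 ≤ s ∧ s ≤ C ∧
    ∀ (c : Fin s ↪ Fin C) (v w : Fin s → Fin q),
      (Finset.univ.filter fun r : Fin R => ∀ i, A r (c i) = v i).card =
        (Finset.univ.filter fun r : Fin R => ∀ i, A r (c i) = w i).card

/-- There is an `OA(R, C, q, s)`. -/
def ExistsOA (R C q s : ℕ) : Prop :=
  ∃ A : Matrix (Fin R) (Fin C) (Fin q), IsOrthogonalArray A s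

/-- Rao's lower bound `∑_{i ≤ ⌊s / 2⌋} (C choose i) (q - 1) ^ i` for the number of rows. -/
def raoBound (C q s : ℕ) : ℕ :=
  ∑ i ∈ Finset.range (s / 2 + 1), C.choose i * (q - 1) ^ i

/-- A family of parameters `(R k, C k, q, s)`, with `q` and `s` fixed, attains Rao's bound
asymptotically: `R k` has the same order of growth as the bound for `C k` columns. -/
def AttainsRaoAsymptotically (R C : ℕ → ℕ) (q s : ℕ) : Prop :=
  Asymptotics.IsTheta Filter.atTop
    (fun k => (R k : ℝ)) (fun k => (raoBound (C k) q s : ℝ))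

/-!
All arrays come from one principle: the rows are the characters of a finite abelian group `M`, the
columns are elements of `M`, and the strength is `s` when no nontrivial relation of weight at most
`s` holds between these elements.

If `M` is a vector space over a finite field `K` and the rows are its linear forms, this says that
any `s` of the columns are linearly independent (`existsOA_of_linearIndependent`). For strength
two the columns represent the points of a projective space. For strength three they are the
vectors `(1, v)` with `v` in a cap of an affine space; caps are stable under products
(`IsAffineCap.pi`), so it suffices to know one small cap: an elliptic quadric with `q ^ 2` points
in three dimensions, and over `𝔽₃` caps of `20`, `45` and `112` points in dimensions four, five
and six. The first of these is the set of nonzero singular vectors of an elliptic form, the last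
is the double of the Hill cap, described by a `2`-`(6, 3, 2)` design, and the middle one is a
hyperplane section of the last. For higher strength the columns are vectors of powers of field
elements; independence follows from the Vandermonde determinant, where over a prime field of order
`p` the Frobenius map supplies the power sums whose exponent is divisible by `p`.

The binary arrays of strength five and seven are the Gray images of `ℤ/4`-linear arrays
(`existsOA_gray`). Here `M` is `ℤ/4 × W` or `ℤ/4 × W × F`, where `F` has `2 ^ (n - 1)` elements
and `W` is the group of Witt vectors of length two over `F`, and the columns are `(1, [x])` or
`(1, [x], x ^ 3)` with the Teichmüller representatives `[x]`. The bits of the Gray map are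
combinations of `i ^ u` and `i ^ (-u)`, so that relations have to be excluded up to a given Lee
weight (`preparata_lee`, `goethals_lee`). A sum of Teichmüller representatives has the first two
elementary symmetric functions as its Witt components; this turns a relation into equations
between symmetric functions of at most six field elements. They are contradictory because `n - 1`
is odd, so that `F` contains no primitive cube root of unity and `a ^ 2 + a * b + b ^ 2` is
anisotropic.

Rao's bound has the order of growth `C ^ (s / 2)` (`isTheta_raoBound`), which decides in each case
whether it is attained asymptotically.
-/

/-! ### Arrays over arbitrary finite types -/

/-- The rows, the columns and the symbols of an orthogonal array may be indexed by any finite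
types. -/
theorem existsOA_of_card_fiber_eq {ρ ι κ : Type*} [Finite ρ] [Finite ι] [Finite κ] [Nonempty ρ]
    {s : ℕ} (hκ : 2 ≤ Nat.card κ) (hs : 2 ≤ s) (hsι : s ≤ Nat.card ι) (A : ρ → ι → κ)
    (h : ∀ (c : Fin s ↪ ι) (v w : Fin s → κ),
      Nat.card {r // ∀ i, A r (c i) = v i} = Nat.card {r // ∀ i, A r (c i) = w i}) :
    ExistsOA (Nat.card ρ) (Nat.card ι) (Nat.card κ) s := by
  let eρ := Finite.equivFin ρ
  let eι := Finite.equivFin ι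
  let eκ := Finite.equivFin κ
  refine ⟨fun r c => eκ (A (eρ.symm r) (eι.symm c)), Nat.card_pos, hκ, hs, hsι, fun c v w => ?_⟩
  have key : ∀ u : Fin s → Fin (Nat.card κ),
      (Finset.univ.filter fun r => ∀ i, eκ (A (eρ.symm r) (eι.symm (c i))) = u i).card =
        Nat.card {r // ∀ i, A r ((c.trans eι.symm.toEmbedding) i) = eκ.symm (u i)} := by
    intro u
    rw [← Fintype.card_subtype, ← Nat.card_eq_fintype_card]
    refine Nat.card_congr (eρ.symm.subtypeEquiv fun r => forall_congr' fun i => ?_)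
    exact (Equiv.eq_symm_apply eκ).symm
  have h' := h (c.trans eι.symm.toEmbedding) (fun i => eκ.symm (v i)) (fun i => eκ.symm (w i))
  exact (key v).trans (h'.trans (key w).symm)

/-- A linear array: the rows are the linear forms on `V`, evaluated at the vectors `v x`. If any
`s` of these vectors are linearly independent, then a form can take arbitrary values on them, and
the forms with prescribed values are the cosets of one subspace. -/
theorem existsOA_of_linearIndependent {K V ι : Type*} [Field K] [Finite K] [AddCommGroup V]
    [Module K V] [Finite V] [Finite ι] {s : ℕ} (hs : 2 ≤ s) (hsι : s ≤ Nat.card ι) (v : ι → V)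
    (h : ∀ (c : Fin s ↪ ι) (g : Fin s → K), ∑ i, g i • v (c i) = 0 → g = 0) :
    ExistsOA (Nat.card V) (Nat.card ι) (Nat.card K) s := by
  have hfin : Module.Finite K V := Module.Finite.of_finite
  have hcard : Nat.card (Module.Dual K V) = Nat.card V := by
    rw [Module.natCard_eq_pow_finrank (K := K), Subspace.dual_finrank_eq,
      ← Module.natCard_eq_pow_finrank]
  have : Finite (Module.Dual K V) := Module.finite_of_finite K
  rw [← hcard]
  refine existsOA_of_card_fiber_eq Finite.one_lt_card hs hsι
    (fun (f : Module.Dual K V) x => f (v x)) fun c a b => ?_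
  have hli : LinearIndependent K fun i => v (c i) :=
    Fintype.linearIndependent_iff.2 fun g hg => congrFun (h c g hg)
  have surj : ∀ a : Fin s → K, ∃ f : Module.Dual K V, ∀ i, f (v (c i)) = a i := by
    intro a
    obtain ⟨f, hf⟩ := ((Module.Basis.span hli).constr K a).exists_extend
    refine ⟨f, fun i => ?_⟩
    have h1 := congrArg (fun F => F (Module.Basis.span hli i)) hf
    simpa [Module.Basis.span_apply, Finsupp.single_apply] using h1
  obtain ⟨f, hf⟩ := surj (b - a)
  refine Nat.card_congr ((Equiv.addRight f).subtypeEquiv fun r => forall_congr' fun i => ?_)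
  simp only [Equiv.coe_addRight, LinearMap.add_apply, hf, Pi.sub_apply]
  rw [← add_sub_assoc, add_sub_right_comm, add_eq_right, sub_eq_zero]

/-! ### Strength two: the points of a projective space -/

theorem existsOA_two (K : Type*) [Field K] [Finite K] {n : ℕ} (hn : 2 ≤ n) :
    ExistsOA (Nat.card K ^ n) ((Nat.card K ^ n - 1) / (Nat.card K - 1)) (Nat.card K) 2 := by
  have hV : Nat.card (Fin n → K) = Nat.card K ^ n := by simp [Nat.card_fun]
  have hP : Nat.card (Projectivization K (Fin n → K)) =
      (Nat.card K ^ n - 1) / (Nat.card K - 1) := by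
    rw [Projectivization.card'', hV]
  have hq : 1 < Nat.card K := Finite.one_lt_card
  have h2 : 2 ≤ Nat.card (Projectivization K (Fin n → K)) := by
    rw [hP, Nat.le_div_iff_mul_le (by omega)]
    have h3 : Nat.card K ^ 2 ≤ Nat.card K ^ n := Nat.pow_le_pow_right (by omega) hn
    have h4 : 2 * Nat.card K ≤ Nat.card K ^ 2 := by nlinarith
    omega
  rw [← hP, ← hV]
  refine existsOA_of_linearIndependent le_rfl h2 Projectivization.rep fun c g hg => ?_
  have hne : c 0 ≠ c 1 := fun h => by simpa using c.injective h
  have hi := (Projectivization.independent_pair_iff_ne (c 0) (c 1)).2 hne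
  rw [Projectivization.independent_iff] at hi
  have := Fintype.linearIndependent_iff.1 hi g (by simpa [Fin.sum_univ_two] using hg)
  exact funext this

/-! ### Strength three: affine caps -/

/-- A cap in an affine space over `K`, given as an injective family of points: no three distinct
points are collinear, so no point of the family lies on the line through two others. -/
def IsAffineCap (K : Type*) {V ι : Type*} [Field K] [AddCommGroup V] [Module K V]
    (v : ι → V) : Prop :=
  Function.Injective v ∧
    ∀ t : K, t ≠ 0 → t ≠ 1 → ∀ i j k, v k = v i + t • (v j - v i) → i = j

/-- Caps are stable under products: in a coordinate where two of three collinear points agree, all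
three do. -/
theorem IsAffineCap.pi {K V ι : Type*} [Field K] [AddCommGroup V] [Module K V] {v : ι → V}
    (hv : IsAffineCap K v) (n : ℕ) :
    IsAffineCap K (fun (x : Fin n → ι) (a : Fin n) => v (x a)) := by
  refine ⟨fun x y h => funext fun a => hv.1 (congrFun h a), fun t h0 h1 i j k h => ?_⟩
  exact funext fun a => hv.2 t h0 h1 (i a) (j a) (k a) (congrFun h a)

/-- Any three of the vectors `(1, v i)` are linearly independent if the `v i` form a cap. -/
theorem IsAffineCap.existsOA {K V ι : Type*} [Field K] [Finite K] [AddCommGroup V] [Module K V]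
    [Finite V] [Finite ι] {v : ι → V} (hv : IsAffineCap K v) (hι : 3 ≤ Nat.card ι) :
    ExistsOA (Nat.card K * Nat.card V) (Nat.card ι) (Nat.card K) 3 := by
  rw [← Nat.card_prod]
  refine existsOA_of_linearIndependent (by norm_num) hι (fun i => ((1 : K), v i)) fun c g hg => ?_
  have hne : ∀ i j, i ≠ j → v (c i) ≠ v (c j) := fun i j hij h => hij (c.injective (hv.1 h))
  simp only [Fin.sum_univ_three, Prod.ext_iff, Prod.fst_add, Prod.snd_add, Prod.smul_fst,
    Prod.smul_snd, Prod.fst_zero, Prod.snd_zero, smul_eq_mul, mul_one] at hg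
  obtain ⟨h1, h2⟩ := hg
  have h0 : g 0 = -(g 1 + g 2) := by linear_combination h1
  by_cases hg2 : g 2 = 0
  · rw [hg2, add_zero] at h0
    rw [h0, hg2, zero_smul, add_zero] at h2
    have h3 : g 1 • (v (c 1) - v (c 0)) = 0 := by rw [← h2]; module
    have hg1 : g 1 = 0 := (smul_eq_zero.1 h3).resolve_right (sub_ne_zero.2 (hne 1 0 (by simp)))
    ext i
    fin_cases i <;> simp [h0, hg1, hg2]
  · exfalso
    have h4 : v (c 2) = v (c 0) + (-(g 1 / g 2)) • (v (c 1) - v (c 0)) := by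
      rw [h0] at h2
      have h5 : g 2 • (v (c 2) - (v (c 0) + (-(g 1 / g 2)) • (v (c 1) - v (c 0)))) = 0 := by
        rw [← h2, smul_sub, smul_add, smul_smul,
          show g 2 * -(g 1 / g 2) = -g 1 by field_simp]
        module
      exact sub_eq_zero.1 ((smul_eq_zero.1 h5).resolve_left hg2)
    by_cases ht0 : -(g 1 / g 2) = 0
    · rw [ht0, zero_smul, add_zero] at h4
      exact hne 2 0 (by simp) h4
    by_cases ht1 : -(g 1 / g 2) = 1
    · rw [ht1, one_smul, add_sub_cancel] at h4
      exact hne 2 1 (by simp) h4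
    exact absurd (c.injective (hv.2 _ ht0 ht1 _ _ _ h4)) (by simp)

/-- Over a finite field some form `x ^ 2 + x * y + c * y ^ 2` is anisotropic: `x ↦ x ^ 2 + x` is
not injective, hence not surjective. -/
theorem exists_anisotropic (K : Type*) [Field K] [Finite K] :
    ∃ c : K, ∀ x y : K, x ^ 2 + x * y + c * y ^ 2 = 0 → x = 0 ∧ y = 0 := by
  have hni : ¬ Function.Injective fun x : K => x ^ 2 + x := fun h => by
    have : (-1 : K) = 0 := h (by ring)
    simp at this
  rw [Finite.injective_iff_surjective, Function.Surjective] at hni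
  push Not at hni
  obtain ⟨c, hc⟩ := hni
  refine ⟨-c, fun x y h => ?_⟩
  have hy : y = 0 := by
    by_contra hy
    refine hc (x / y) ?_
    field_simp
    linear_combination h
  subst hy
  simpa using h

/-- The affine part of an elliptic quadric. For a quadratic form `Q` the point of the line through
`(a, Q a)` and `(b, Q b)` over `(1 - t) a + t b` differs from the graph of `Q` by
`t (1 - t) Q (a - b)`. -/
theorem isAffineCap_ellipticQuadric {K : Type*} [Field K] {c : K}
    (hc : ∀ x y : K, x ^ 2 + x * y + c * y ^ 2 = 0 → x = 0 ∧ y = 0) :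
    IsAffineCap K
      (fun p : K × K => (p.1, p.2, p.1 ^ 2 + p.1 * p.2 + c * p.2 ^ 2)) := by
  refine ⟨fun p q h => ?_, fun t h0 h1 i j k h => ?_⟩
  · simp only [Prod.mk.injEq] at h
    exact Prod.ext h.1 h.2.1
  · simp only [Prod.mk_sub_mk, Prod.smul_mk, Prod.mk_add_mk, Prod.mk.injEq, smul_eq_mul] at h
    obtain ⟨e1, e2, e3⟩ := h
    have h4 : t * (1 - t) * ((i.1 - j.1) ^ 2 + (i.1 - j.1) * (i.2 - j.2)
        + c * (i.2 - j.2) ^ 2) = 0 := by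
      rw [e1, e2] at e3
      linear_combination -e3
    have h5 := hc _ _ ((mul_eq_zero.1 h4).resolve_left
      (mul_ne_zero h0 (sub_ne_zero.2 (Ne.symm h1))))
    exact Prod.ext (sub_eq_zero.1 h5.1) (sub_eq_zero.1 h5.2)

theorem existsOA_three (K : Type*) [Field K] [Finite K] {n : ℕ} (hn : 1 ≤ n) :
    ExistsOA (Nat.card K ^ (3 * n + 1)) (Nat.card K ^ (2 * n)) (Nat.card K) 3 := by
  obtain ⟨c, hc⟩ := exists_anisotropic K
  have h := ((isAffineCap_ellipticQuadric hc).pi n).existsOA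
  have hq : 2 ≤ Nat.card K := Finite.one_lt_card
  have hC : Nat.card (Fin n → K × K) = Nat.card K ^ (2 * n) := by
    simp [Nat.card_fun, pow_mul, sq]
  have hR : Nat.card K * Nat.card (Fin n → K × K × K) = Nat.card K ^ (3 * n + 1) := by
    rw [pow_succ', pow_mul]
    simp [Nat.card_fun, pow_succ, mul_assoc]
  rw [hC, hR] at h
  refine h ?_
  calc 3 ≤ 2 ^ 2 := by norm_num
    _ ≤ Nat.card K ^ 2 := Nat.pow_le_pow_left hq 2
    _ ≤ Nat.card K ^ (2 * n) := Nat.pow_le_pow_right (by omega) (by omega)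

/-! ### Power sums: Reed–Solomon and BCH arrays -/

theorem eq_zero_of_sum_smul_pow_eq_zero {K L : Type*} [Field K] [Field L] [Algebra K L] {s : ℕ}
    {x : Fin s → L} (hx : Function.Injective x) {g : Fin s → K}
    (h : ∀ j < s, ∑ i, g i • x i ^ j = 0) : g = 0 := by
  have h1 : (fun i => algebraMap K L (g i)) = 0 :=
    Matrix.eq_zero_of_forall_pow_sum_mul_pow_eq_zero hx fun j => by
      simpa [Algebra.smul_def] using h j j.2
  exact funext fun i => (map_eq_zero (algebraMap K L)).1 (congrFun h1 i)

/-- Coefficients in the prime field are fixed by the Frobenius map, which therefore carries the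
`k`-th weighted power sum to the `p * k`-th. -/
theorem sum_smul_pow_mul_char {p : ℕ} [Fact p.Prime] {L : Type*} [Field L] [Algebra (ZMod p) L]
    {s : ℕ} (x : Fin s → L) (g : Fin s → ZMod p) (k : ℕ) :
    ∑ i, g i • x i ^ (p * k) = (∑ i, g i • x i ^ k) ^ p := by
  have : CharP L p := (Algebra.charP_iff (ZMod p) L p).1 inferInstance
  rw [sum_pow_char]
  refine Finset.sum_congr rfl fun i _ => ?_
  rw [smul_pow, ZMod.pow_card, ← pow_mul, mul_comm]

theorem sum_smul_pow_eq_zero_of_odd {L : Type*} [Field L] [Algebra (ZMod 2) L] {s t : ℕ}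
    {x : Fin s → L} {g : Fin s → ZMod 2}
    (h : ∀ j < t, ∑ i, g i • x i ^ (2 * j + 1) = 0) (m : ℕ) (hm : 1 ≤ m) (hmt : m ≤ 2 * t) :
    ∑ i, g i • x i ^ m = 0 := by
  induction m using Nat.strong_induction_on with
  | _ m ih =>
    obtain ⟨k, hk | hk⟩ := Nat.even_or_odd' m
    · rw [hk, sum_smul_pow_mul_char, ih k (by omega) (by omega) (by omega), zero_pow two_ne_zero]
    · rw [hk]
      exact h k (by omega)

/-- The columns `(1, x, …, x ^ (s - 1))`. -/
theorem existsOA_reedSolomon {p : ℕ} [Fact p.Prime] {s n : ℕ} (hs : 2 ≤ s) (hn : 1 ≤ n)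
    (hsn : s ≤ p ^ n) : ExistsOA (p ^ (n * s)) (p ^ n) p s := by
  have hL : Nat.card (GaloisField p n) = p ^ n := GaloisField.card p n (by omega)
  have h := existsOA_of_linearIndependent (K := ZMod p) hs (hL.symm ▸ hsn)
    (fun (x : GaloisField p n) (j : Fin s) => x ^ (j : ℕ)) fun c g hg =>
      eq_zero_of_sum_smul_pow_eq_zero c.injective fun j hj => by
        simpa using congrFun hg ⟨j, hj⟩
  simpa [Nat.card_fun, hL, ← pow_mul] using h

/-- The columns `(1, x, x ^ 2)`: the third power sum comes from the first by Frobenius. -/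
theorem existsOA_three_four {n : ℕ} (hn : 2 ≤ n) :
    ExistsOA (3 ^ (2 * n + 1)) (3 ^ n) 3 4 := by
  have hL : Nat.card (GaloisField 3 n) = 3 ^ n := GaloisField.card 3 n (by omega)
  have h4 : 4 ≤ 3 ^ n := le_trans (by norm_num) (Nat.pow_le_pow_right (by norm_num) hn)
  have h := existsOA_of_linearIndependent (K := ZMod 3) (by norm_num) (hL.symm ▸ h4)
    (fun x : GaloisField 3 n => ((1 : ZMod 3), x, x ^ 2)) fun c g hg => by
      simp only [Prod.ext_iff, Prod.fst_sum, Prod.snd_sum, Prod.smul_fst, Prod.smul_snd,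
        Prod.fst_zero, Prod.snd_zero, smul_eq_mul, mul_one] at hg
      obtain ⟨h0, h1, h2⟩ := hg
      refine eq_zero_of_sum_smul_pow_eq_zero (L := GaloisField 3 n) c.injective fun j hj => ?_
      interval_cases j
      · simp only [pow_zero]
        rw [← Finset.sum_smul, h0, zero_smul]
      · simpa using h1
      · exact h2
      · refine (sum_smul_pow_mul_char (p := 3) c g 1).trans ?_
        simp [h1]
  have e : 3 * (3 ^ n * 3 ^ n) = 3 ^ (2 * n + 1) := by ring
  simpa [Nat.card_fun, hL, e] using h

/-- The columns `(x, x ^ 3, …, x ^ (2 * t - 1))` for `x ≠ 0`. -/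
theorem existsOA_bch_even {t n : ℕ} (ht : 1 ≤ t) (hn : 1 ≤ n) (htn : 2 * t ≤ 2 ^ n - 1) :
    ExistsOA (2 ^ (n * t)) (2 ^ n - 1) 2 (2 * t) := by
  have hL : Nat.card (GaloisField 2 n) = 2 ^ n := GaloisField.card 2 n (by omega)
  have hU : Nat.card (GaloisField 2 n)ˣ = 2 ^ n - 1 := by rw [Nat.card_units, hL]
  have h := existsOA_of_linearIndependent (K := ZMod 2) (by omega) (hU.symm ▸ htn)
    (fun (x : (GaloisField 2 n)ˣ) (j : Fin t) => (x : GaloisField 2 n) ^ (2 * (j : ℕ) + 1))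
    fun c g hg => by
      have h0 := sum_smul_pow_eq_zero_of_odd (x := fun i => (c i : GaloisField 2 n)) (g := g)
        (t := t) fun j hj => by simpa using congrFun hg ⟨j, hj⟩
      have h1 : (fun i => g i • (c i : GaloisField 2 n)) = 0 :=
        Matrix.eq_zero_of_forall_pow_sum_mul_pow_eq_zero (Units.val_injective.comp c.injective)
          fun j => by
            rw [← h0 (j + 1) (by omega) (by omega)]
            exact Finset.sum_congr rfl fun i _ => by simp [pow_succ']
      exact funext fun i => (smul_eq_zero.1 (congrFun h1 i)).resolve_right (c i).ne_zero
  simpa [Nat.card_fun, hL, hU, ← pow_mul] using h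

/-- The columns `(1, x, x ^ 3, …, x ^ (2 * t - 1))` for all `x`. -/
theorem existsOA_bch_odd {t n : ℕ} (ht : 1 ≤ t) (hn : 1 ≤ n) (htn : 2 * t + 1 ≤ 2 ^ n) :
    ExistsOA (2 ^ (1 + n * t)) (2 ^ n) 2 (2 * t + 1) := by
  have hL : Nat.card (GaloisField 2 n) = 2 ^ n := GaloisField.card 2 n (by omega)
  have h := existsOA_of_linearIndependent (K := ZMod 2) (by omega) (hL.symm ▸ htn)
    (fun x : GaloisField 2 n => ((1 : ZMod 2), fun j : Fin t => x ^ (2 * (j : ℕ) + 1)))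
    fun c g hg => by
      simp only [Prod.ext_iff, Prod.fst_sum, Prod.snd_sum, Prod.smul_fst, Prod.smul_snd,
        Prod.fst_zero, Prod.snd_zero, smul_eq_mul, mul_one] at hg
      obtain ⟨h0, h1⟩ := hg
      have h2 := sum_smul_pow_eq_zero_of_odd (x := c) (g := g) (t := t)
        fun j hj => by simpa using congrFun h1 ⟨j, hj⟩
      refine eq_zero_of_sum_smul_pow_eq_zero (L := GaloisField 2 n) c.injective fun j hj => ?_
      rcases Nat.eq_zero_or_pos j with rfl | hj0
      · simp only [pow_zero]
        rw [← Finset.sum_smul, h0, zero_smul]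
      · exact h2 j hj0 (by omega)
  have e : 2 * (2 ^ n) ^ t = 2 ^ (1 + n * t) := by rw [pow_add, pow_mul, pow_one]
  simpa [Nat.card_fun, hL, e] using h

theorem addChar_sum {M X : Type*} [AddCommMonoid M] (ψ : AddChar M ℂ) (s : Finset X)
    (f : X → M) : ψ (∑ x ∈ s, f x) = ∏ x ∈ s, ψ (f x) :=
  map_prod ψ.toMonoidHom (fun x => Multiplicative.ofAdd (f x)) s

/-! ### Binary arrays from vanishing correlations -/

/-- The sign of a binary symbol. -/
def boolSign (b : Bool) : ℂ := if b then 1 else -1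

theorem one_add_boolSign_mul (a b : Bool) :
    1 + boolSign a * boolSign b = if a = b then 2 else 0 := by
  cases a <;> cases b <;> norm_num [boolSign]

/-- If the signs in every nonempty set of at most `s` columns are uncorrelated, then the array has
strength `s`: the indicator function of a prescribed row in `s` columns expands into products of
signs, of which only the constant one contributes to the count. -/
theorem existsOA_of_sum_prod_boolSign_eq_zero {ρ ι : Type*} [Fintype ρ] [Finite ι] [Nonempty ρ]
    {s : ℕ} (hs : 2 ≤ s) (hsι : s ≤ Nat.card ι) (A : ρ → ι → Bool)
    (h : ∀ S : Finset ι, S.Nonempty → S.card ≤ s → ∑ r, ∏ j ∈ S, boolSign (A r j) = 0) :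
    ExistsOA (Nat.card ρ) (Nat.card ι) 2 s := by
  have key : ∀ (c : Fin s ↪ ι) (v : Fin s → Bool),
      (2 : ℂ) ^ s * (Nat.card {r // ∀ i, A r (c i) = v i} : ℂ) = Nat.card ρ := by
    intro c v
    have h1 : ∀ r, (if ∀ i, A r (c i) = v i then (2 : ℂ) ^ s else 0) =
        ∏ i, (1 + boolSign (A r (c i)) * boolSign (v i)) := by
      intro r
      simp_rw [one_add_boolSign_mul]
      rw [Finset.prod_ite_zero]
      simp
    calc (2 : ℂ) ^ s * (Nat.card {r // ∀ i, A r (c i) = v i} : ℂ)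
        = ∑ r, if ∀ i, A r (c i) = v i then (2 : ℂ) ^ s else 0 := by
          rw [Nat.card_eq_fintype_card, Fintype.card_subtype, ← Finset.sum_filter,
            Finset.sum_const, nsmul_eq_mul, mul_comm]
      _ = ∑ T : Finset (Fin s),
            (∏ i ∈ T, boolSign (v i)) * ∑ r, ∏ i ∈ T, boolSign (A r (c i)) := by
          simp_rw [h1, Finset.prod_one_add, Finset.powerset_univ]
          rw [Finset.sum_comm]
          simp_rw [Finset.prod_mul_distrib, Finset.mul_sum, mul_comm]
      _ = Nat.card ρ := by
          rw [Finset.sum_eq_single ∅]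
          · simp
          · intro T _ hT
            have h2 := h (T.map c) ((Finset.nonempty_iff_ne_empty.2 hT).map)
              (by simpa using T.card_le_univ)
            simp only [Finset.prod_map] at h2
            rw [h2, mul_zero]
          · simp
  have h2 := existsOA_of_card_fiber_eq (κ := Bool) (by simp) hs hsι A fun c v w => by
    have h3 := (key c v).trans (key c w).symm
    exact_mod_cast mul_left_cancel₀ (pow_ne_zero s two_ne_zero) h3
  simpa using h2

/-! ### The Gray map -/

/-- The Lee weight on `ℤ/4`. -/
def leeWeight (w : ZMod 4) : ℕ := w.valMinAbs.natAbs

/-- The two bits of the Gray map, read off from a fourth root of unity `z`. -/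
noncomputable def grayBit (z : ℂ) : Bool → Bool
  | false => decide (z = 1 ∨ z = Complex.I)
  | true => decide (z = 1 ∨ z = -Complex.I)

/-- The Fourier coefficients on `ℤ/4` of the product of the signs of the Gray bits: the first bit
is present if `p` holds, the second one if `q` holds. -/
noncomputable def grayCoeff : Bool → Bool → ZMod 4 → ℂ
  | false, false => ![1, 0, 0, 0]
  | true, false => ![0, (1 - Complex.I) / 2, 0, (1 + Complex.I) / 2]
  | false, true => ![0, (1 + Complex.I) / 2, 0, (1 - Complex.I) / 2]
  | true, true => ![0, 0, 1, 0]

theorem sum_vec_mul_pow_val (a b c d z : ℂ) :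
    ∑ w : ZMod 4, (![a, b, c, d] : ZMod 4 → ℂ) w * z ^ w.val =
      a + b * z + c * z ^ 2 + d * z ^ 3 := by
  refine (Fin.sum_univ_four _).trans ?_
  change a * z ^ 0 + b * z ^ 1 + c * z ^ 2 + d * z ^ 3 = _
  ring

theorem sum_grayCoeff_mul_pow (p q : Bool) {z : ℂ} (hz : z ^ 4 = 1) :
    (if p then boolSign (grayBit z false) else 1) * (if q then boolSign (grayBit z true) else 1) =
      ∑ w : ZMod 4, grayCoeff p q w * z ^ w.val := by
  have h : (z - 1) * (z + 1) * (z - Complex.I) * (z + Complex.I) = 0 := by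
    linear_combination hz + (1 - z ^ 2) * Complex.I_sq
  have hcases : z = 1 ∨ z = -1 ∨ z = Complex.I ∨ z = -Complex.I := by
    simpa [sub_eq_zero, ← eq_neg_iff_add_eq_zero, or_assoc] using h
  rcases hcases with rfl | rfl | rfl | rfl <;> cases p <;> cases q <;>
    simp only [grayCoeff, sum_vec_mul_pow_val] <;>
    norm_num [grayBit, boolSign, Complex.ext_iff, pow_succ]

theorem leeWeight_of_grayCoeff_ne_zero {p q : Bool} {w : ZMod 4} (h : grayCoeff p q w ≠ 0) :
    leeWeight w = p.toNat + q.toNat := by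
  cases p <;> cases q <;> fin_cases w <;> first | rfl | exact absurd rfl h

/-- The Gray image of a linear array over `ℤ/4`. The rows are the characters of a group `M` of
exponent `4`, evaluated at the elements `v x`; each value, a fourth root of unity, gives two bits.
A product of signs in `k` columns is a combination of the characters at elements `∑ w x • v x` with
`w` of Lee weight `k`, so its sum over the rows vanishes if these elements are nonzero. -/
theorem existsOA_gray {M X : Type*} [AddCommGroup M] [Finite M] [Finite X]
    (hM : ∀ m : M, 4 • m = 0) {s : ℕ} (hs : 2 ≤ s) (hsX : s ≤ 2 * Nat.card X) (v : X → M)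
    (h : ∀ [Fintype X] (w : X → ZMod 4), w ≠ 0 → ∑ x, leeWeight (w x) ≤ s →
      ∑ x, (w x).val • v x ≠ 0) :
    ExistsOA (Nat.card M) (2 * Nat.card X) 2 s := by
  classical
  have := Fintype.ofFinite X
  have := Fintype.ofFinite M
  have hρ : Nat.card (AddChar M ℂ) = Nat.card M := by
    rw [Nat.card_eq_fintype_card, AddChar.card_eq, Nat.card_eq_fintype_card]
  have hι : Nat.card (X × Bool) = 2 * Nat.card X := by simp [mul_comm]
  rw [← hρ, ← hι]
  refine existsOA_of_sum_prod_boolSign_eq_zero hs (hι.symm ▸ hsX)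
    (fun (ψ : AddChar M ℂ) j => grayBit (ψ (v j.1)) j.2) fun S hS hSs => ?_
  have hψ : ∀ (ψ : AddChar M ℂ) (m : M), ψ m ^ 4 = 1 := fun ψ m => by
    rw [← AddChar.map_nsmul_eq_pow, hM, AddChar.map_zero_eq_one]
  let p : X → Bool := fun x => decide ((x, false) ∈ S)
  let q : X → Bool := fun x => decide ((x, true) ∈ S)
  have hcard : S.card = ∑ x, ((p x).toNat + (q x).toNat) := by
    have h1 : S.card = ∑ j, if j ∈ S then 1 else 0 := by simp
    rw [h1, Fintype.sum_prod_type]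
    refine Finset.sum_congr rfl fun x _ => ?_
    rw [Fintype.sum_bool, add_comm]
    simp [p, q, Bool.toNat, Bool.cond_decide]
  have hexp : ∀ ψ : AddChar M ℂ, ∏ j ∈ S, boolSign (grayBit (ψ (v j.1)) j.2) =
      ∑ w : X → ZMod 4, (∏ x, grayCoeff (p x) (q x) (w x)) * ψ (∑ x, (w x).val • v x) := by
    intro ψ
    have h1 : ∏ j ∈ S, boolSign (grayBit (ψ (v j.1)) j.2) =
        ∏ j, if j ∈ S then boolSign (grayBit (ψ (v j.1)) j.2) else 1 := by simp
    rw [h1, Fintype.prod_prod_type]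
    have h2 : ∀ x : X, (∏ b, if (x, b) ∈ S then boolSign (grayBit (ψ (v x)) b) else 1) =
        ∑ w : ZMod 4, grayCoeff (p x) (q x) w * ψ (v x) ^ w.val := by
      intro x
      rw [← sum_grayCoeff_mul_pow _ _ (hψ ψ (v x)), Fintype.prod_bool, mul_comm]
      simp [p, q]
    simp_rw [h2]
    rw [Finset.prod_univ_sum, Fintype.piFinset_univ]
    refine Finset.sum_congr rfl fun w _ => ?_
    rw [Finset.prod_mul_distrib, addChar_sum]
    simp_rw [AddChar.map_nsmul_eq_pow]
  simp_rw [hexp]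
  rw [Finset.sum_comm]
  refine Finset.sum_eq_zero fun w _ => ?_
  rw [← Finset.mul_sum, AddChar.sum_apply_eq_ite]
  by_cases hw : ∏ x, grayCoeff (p x) (q x) (w x) = 0
  · rw [hw, zero_mul]
  have hlee : ∑ x, leeWeight (w x) = S.card := by
    rw [hcard]
    refine Finset.sum_congr rfl fun x hx => leeWeight_of_grayCoeff_ne_zero ?_
    exact Finset.prod_ne_zero_iff.1 hw x hx
  rw [if_neg (h w ?_ (hlee.trans_le hSs)), mul_zero]
  rintro rfl
  have : S.card = 0 := by rw [← hlee]; simp [leeWeight]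
  exact hS.card_pos.ne' this

/-! ### Fields of characteristic two without primitive cube roots of unity -/

section CharTwo

variable {F : Type*} [Field F] [CharP F 2]

/-- If `x ^ 2 + x * y + y ^ 2` is anisotropic, four elements of `F` whose first two elementary
symmetric functions vanish are equal. -/
theorem eq_of_esymm_four (hF : ∀ a b : F, a ^ 2 + a * b + b ^ 2 = 0 → a = 0 ∧ b = 0)
    {x₁ x₂ x₃ x₄ : F} (h1 : x₁ + x₂ + x₃ + x₄ = 0)
    (h2 : x₁ * x₂ + x₁ * x₃ + x₁ * x₄ + x₂ * x₃ + x₂ * x₄ + x₃ * x₄ = 0) : x₁ = x₂ := by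
  have two : (2 : F) = 0 := CharTwo.two_eq_zero
  have h := hF (x₁ + x₄) (x₂ + x₄) (by grind)
  grind

/-- The reciprocals of nonzero elements with vanishing second and third elementary symmetric
functions have vanishing first and second ones. -/
theorem eq_of_esymm_four_inv (hF : ∀ a b : F, a ^ 2 + a * b + b ^ 2 = 0 → a = 0 ∧ b = 0)
    {x₁ x₂ x₃ x₄ : F} (n1 : x₁ ≠ 0) (n2 : x₂ ≠ 0) (n3 : x₃ ≠ 0) (n4 : x₄ ≠ 0)
    (h2 : x₁ * x₂ + x₁ * x₃ + x₁ * x₄ + x₂ * x₃ + x₂ * x₄ + x₃ * x₄ = 0)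
    (h3 : x₁ * x₂ * x₃ + x₁ * x₂ * x₄ + x₁ * x₃ * x₄ + x₂ * x₃ * x₄ = 0) : x₁ = x₂ := by
  refine inv_injective (eq_of_esymm_four hF (x₃ := x₃⁻¹) (x₄ := x₄⁻¹) ?_ ?_)
  · field_simp
    linear_combination h3
  · field_simp
    linear_combination h2

/-- Two disjoint sets, of five and of one element, cannot have equal sums and equal sums of cubes
if the second elementary symmetric function vanishes: the differences of four of the five elements
with the remaining one are covered by `eq_of_esymm_four_inv`. -/
theorem eq_of_sum_five (hF : ∀ a b : F, a ^ 2 + a * b + b ^ 2 = 0 → a = 0 ∧ b = 0)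
    {x₁ x₂ x₃ x₄ x₅ p : F} (n1 : x₁ ≠ x₅) (n2 : x₂ ≠ x₅) (n3 : x₃ ≠ x₅) (n4 : x₄ ≠ x₅)
    (h1 : x₁ + x₂ + x₃ + x₄ + x₅ = p)
    (h2 : x₁ * x₂ + x₁ * x₃ + x₁ * x₄ + x₁ * x₅ + x₂ * x₃ + x₂ * x₄ + x₂ * x₅ + x₃ * x₄ + x₃ * x₅
      + x₄ * x₅ = 0)
    (h3 : x₁ ^ 3 + x₂ ^ 3 + x₃ ^ 3 + x₄ ^ 3 + x₅ ^ 3 = p ^ 3) : x₁ = x₂ := by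
  have two : (2 : F) = 0 := CharTwo.two_eq_zero
  have h := eq_of_esymm_four_inv hF (sub_ne_zero.2 n1) (sub_ne_zero.2 n2) (sub_ne_zero.2 n3)
    (sub_ne_zero.2 n4) (by grind) (by grind)
  exact sub_left_injective h

theorem mem_of_sum_pair {F : Type*} [Field F] {x₁ x₂ y₁ y₂ : F} (h1 : x₁ + x₂ = y₁ + y₂)
    (h2 : x₁ * x₂ = y₁ * y₂) :
    x₁ = y₁ ∨ x₁ = y₂ := by
  have h : (x₁ - y₁) * (x₁ - y₂) = 0 := by linear_combination x₁ * h1 - h2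
  simpa [sub_eq_zero] using h

/-- Two triples with the same sum, the same second elementary symmetric function and the same sum of
cubes are the roots of one cubic polynomial. -/
theorem mem_of_sum_triple {x₁ x₂ x₃ y₁ y₂ y₃ : F} (h1 : x₁ + x₂ + x₃ = y₁ + y₂ + y₃)
    (h2 : x₁ * x₂ + x₁ * x₃ + x₂ * x₃ = y₁ * y₂ + y₁ * y₃ + y₂ * y₃)
    (h3 : x₁ ^ 3 + x₂ ^ 3 + x₃ ^ 3 = y₁ ^ 3 + y₂ ^ 3 + y₃ ^ 3) :
    x₁ = y₁ ∨ x₁ = y₂ ∨ x₁ = y₃ := by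
  have two : (2 : F) = 0 := CharTwo.two_eq_zero
  have h : (x₁ - y₁) * ((x₁ - y₂) * (x₁ - y₃)) = 0 := by grind
  simpa [sub_eq_zero] using h

/-- Four elements with sum zero have `(x₁ - x₂) (x₁ - x₃) (x₂ - x₃)` as their sum of cubes. -/
theorem eq_of_sum_cubes_four {x₁ x₂ x₃ x₄ : F} (h1 : x₁ + x₂ + x₃ + x₄ = 0)
    (h3 : x₁ ^ 3 + x₂ ^ 3 + x₃ ^ 3 + x₄ ^ 3 = 0) : x₁ = x₂ ∨ x₁ = x₃ ∨ x₂ = x₃ := by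
  have two : (2 : F) = 0 := CharTwo.two_eq_zero
  have h : (x₁ - x₂) * ((x₁ - x₃) * (x₂ - x₃)) = 0 := by grind
  simpa [sub_eq_zero] using h

end CharTwo

/-- In a field with `2 ^ m` elements, `m` odd, the cube map is injective, so that
`a ^ 2 + a * b + b ^ 2 = (a ^ 3 - b ^ 3) / (a - b)` is anisotropic. -/
theorem anisotropic_of_odd {m : ℕ} (hm : Odd m) (a b : GaloisField 2 m)
    (h : a ^ 2 + a * b + b ^ 2 = 0) : a = 0 ∧ b = 0 := by
  have two : (2 : GaloisField 2 m) = 0 := CharTwo.two_eq_zero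
  have hcard : Nat.card (GaloisField 2 m) = 2 ^ m := GaloisField.card 2 m hm.pos.ne'
  have := Fintype.ofFinite (GaloisField 2 m)
  by_cases hb : b = 0
  · simpa [hb] using h
  exfalso
  have ha : a ≠ 0 := by
    rintro rfl
    simp [hb] at h
  have h3 : (a / b) ^ 3 = 1 := by
    field_simp
    linear_combination (a - b) * h
  have h4 : (a / b) ^ (2 ^ m - 1) = 1 := by
    rw [← hcard, Nat.card_eq_fintype_card]
    exact FiniteField.pow_card_sub_one_eq_one _ (div_ne_zero ha hb)
  obtain ⟨k, rfl⟩ := hm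
  have h5 : Nat.gcd 3 (2 ^ (2 * k + 1) - 1) = 1 := by
    have h6 : 2 ^ (2 * k + 1) % 3 = 2 := by
      rw [pow_succ, pow_mul, Nat.mul_mod, Nat.pow_mod]
      simp
    refine (Nat.Prime.coprime_iff_not_dvd Nat.prime_three).2 ?_
    generalize 2 ^ (2 * k + 1) = N at h6
    omega
  have h7 : orderOf (a / b) ∣ Nat.gcd 3 (2 ^ (2 * k + 1) - 1) :=
    Nat.dvd_gcd (orderOf_dvd_of_pow_eq_one h3) (orderOf_dvd_of_pow_eq_one h4)
  rw [h5, Nat.dvd_one, orderOf_eq_one_iff, div_eq_one_iff_eq hb] at h7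
  subst h7
  exact pow_ne_zero 2 ha (by linear_combination h - a ^ 2 * two)

/-! ### Witt vectors of length two -/

/-- The additive group of the Witt vectors of length two over a ring `F` of characteristic two,
with Witt components `(a, b)`. In these terms the sum of the Teichmüller representatives `(x, 0)`
of a set of elements has the first two elementary symmetric functions as components. -/
@[ext]
structure WittTwo (F : Type*) where
  /-- The Teichmüller component. -/
  fst : F
  /-- The second Witt component. -/
  snd : F

namespace WittTwo

/-- The pair of Witt components. -/
def equivProd (F : Type*) : WittTwo F ≃ F × F where
  toFun a := (a.fst, a.snd)
  invFun p := ⟨p.1, p.2⟩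

instance (F : Type*) [Finite F] : Finite (WittTwo F) := Finite.of_equiv _ (equivProd F).symm

variable {F : Type*} [CommRing F]

instance : Add (WittTwo F) := ⟨fun a b => ⟨a.fst + b.fst, a.snd + b.snd + a.fst * b.fst⟩⟩

instance : Zero (WittTwo F) := ⟨⟨0, 0⟩⟩

instance : Neg (WittTwo F) := ⟨fun a => ⟨-a.fst, -a.snd + a.fst ^ 2⟩⟩

@[simp] theorem fst_add (a b : WittTwo F) : (a + b).fst = a.fst + b.fst := rfl

@[simp] theorem snd_add (a b : WittTwo F) : (a + b).snd = a.snd + b.snd + a.fst * b.fst := rfl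

@[simp] theorem fst_zero : (0 : WittTwo F).fst = 0 := rfl

@[simp] theorem snd_zero : (0 : WittTwo F).snd = 0 := rfl

@[simp] theorem fst_neg (a : WittTwo F) : (-a).fst = -a.fst := rfl

@[simp] theorem snd_neg (a : WittTwo F) : (-a).snd = -a.snd + a.fst ^ 2 := rfl

instance : AddCommGroup (WittTwo F) where
  add_assoc a b c := by ext <;> simp <;> ring
  zero_add a := by ext <;> simp
  add_zero a := by ext <;> simp
  neg_add_cancel a := by ext <;> simp; ring
  add_comm a b := by ext <;> simp <;> ring
  nsmul := nsmulRec
  zsmul := zsmulRec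

/-- The Teichmüller representative. -/
def teichmuller (x : F) : WittTwo F := ⟨x, 0⟩

theorem fst_sum_teichmuller (S : Finset F) : (∑ x ∈ S, teichmuller x).fst = ∑ x ∈ S, x := by
  classical
  induction S using Finset.induction_on with
  | empty => rfl
  | insert a S ha ih => rw [Finset.sum_insert ha, Finset.sum_insert ha, fst_add, ih]; rfl

theorem two_nsmul_eq [CharP F 2] (a : WittTwo F) : 2 • a = ⟨0, a.fst ^ 2⟩ := by
  rw [two_nsmul]
  ext
  · exact CharTwo.add_self_eq_zero a.fst
  · rw [snd_add, CharTwo.add_self_eq_zero, zero_add, sq]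

theorem four_nsmul_eq_zero [CharP F 2] (a : WittTwo F) : 4 • a = 0 := by
  rw [show 4 = 2 * 2 from rfl, mul_nsmul, two_nsmul_eq, two_nsmul_eq]
  ext <;> simp

/-- A `ℤ/4`-linear relation between Teichmüller representatives, with coefficients `1`, `-1` and `2`
on `P`, `N` and `B`: the components say that `P` and `N` have the same sum and that their second
elementary symmetric functions differ by the square of the sum of `B`. -/
theorem sum_eq_of_relation [CharP F 2] {P N B : Finset F}
    (h : ∑ x ∈ P, teichmuller x + 3 • ∑ x ∈ N, teichmuller x + 2 • ∑ x ∈ B, teichmuller x = 0) :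
    ∑ x ∈ P, x = ∑ x ∈ N, x ∧
      (∑ x ∈ P, teichmuller x).snd + (∑ x ∈ N, teichmuller x).snd = (∑ x ∈ B, x) ^ 2 := by
  rw [show 3 = 2 + 1 from rfl, add_nsmul, one_nsmul, two_nsmul_eq, two_nsmul_eq] at h
  have h1 := congrArg WittTwo.fst h
  have h2 := congrArg WittTwo.snd h
  simp only [fst_add, snd_add, fst_zero, snd_zero, fst_sum_teichmuller] at h1 h2
  have two : (2 : F) = 0 := CharTwo.two_eq_zero
  constructor <;> grind

end WittTwo

/-! ### The Kerdock and Delsarte–Goethals arrays -/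

section Lee

variable {X : Type*} [Fintype X] (w : X → ZMod 4)

/-- A linear combination over `ℤ/4`, sorted by the coefficients `1`, `3` and `2`. -/
theorem sum_val_nsmul {M : Type*} [AddCommMonoid M] (g : X → M) :
    ∑ x, (w x).val • g x = ∑ x with w x = 1, g x + 3 • ∑ x with w x = 3, g x +
      2 • ∑ x with w x = 2, g x := by
  simp only [Finset.sum_filter, Finset.smul_sum, ← Finset.sum_add_distrib]
  refine Finset.sum_congr rfl fun x _ => ?_
  generalize w x = a
  have h0 : ZMod.val (0 : ZMod 4) = 0 := rfl
  have h1 : ZMod.val (1 : ZMod 4) = 1 := rfl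
  have h2 : ZMod.val (2 : ZMod 4) = 2 := rfl
  have h3 : ZMod.val (3 : ZMod 4) = 3 := rfl
  have : a = 0 ∨ a = 1 ∨ a = 2 ∨ a = 3 := by revert a; decide
  have e01 : (0 : ZMod 4) ≠ 1 := by decide
  have e02 : (0 : ZMod 4) ≠ 2 := by decide
  have e03 : (0 : ZMod 4) ≠ 3 := by decide
  have e12 : (1 : ZMod 4) ≠ 2 := by decide
  have e13 : (1 : ZMod 4) ≠ 3 := by decide
  have e23 : (2 : ZMod 4) ≠ 3 := by decide
  rcases this with rfl | rfl | rfl | rfl <;>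
    simp [h0, h1, h2, h3, e01, e02, e03, e12, e13, e23, e12.symm, e13.symm, e23.symm]

theorem sum_leeWeight :
    ∑ x, leeWeight (w x) = (Finset.univ.filter fun x => w x = 1).card +
      (Finset.univ.filter fun x => w x = 3).card +
      2 * (Finset.univ.filter fun x => w x = 2).card := by
  simp only [Finset.card_filter, Finset.mul_sum, ← Finset.sum_add_distrib]
  refine Finset.sum_congr rfl fun x _ => ?_
  generalize w x = a
  revert a
  decide

end Lee

section Relations

open WittTwo

theorem not_disjoint_of_card_eq_two {F : Type*} [Field F] [DecidableEq F] {P N : Finset F}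
    (hP : P.card = 2) (hN : N.card = 2)
    (h1 : ∑ x ∈ P, x = ∑ x ∈ N, x)
    (h2 : (∑ x ∈ P, teichmuller x).snd = (∑ x ∈ N, teichmuller x).snd) : ¬ Disjoint P N := by
  obtain ⟨a, b, hab, rfl⟩ := Finset.card_eq_two.1 hP
  obtain ⟨c, d, hcd, rfl⟩ := Finset.card_eq_two.1 hN
  simp [Finset.sum_insert, teichmuller, *] at h1 h2
  have := mem_of_sum_pair h1 h2
  simp
  grind

variable {F : Type*} [Field F] [CharP F 2] [DecidableEq F]

theorem sum_ne_zero_of_card_eq_two {T : Finset F} (hT : T.card = 2) : ∑ x ∈ T, x ≠ 0 := by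
  obtain ⟨a, b, hab, rfl⟩ := Finset.card_eq_two.1 hT
  rw [Finset.sum_pair hab]
  exact fun h => hab (CharTwo.add_eq_zero.1 h)

theorem sum_cubes_ne_zero_of_card_eq_four {T : Finset F} (hT : T.card = 4)
    (h1 : ∑ x ∈ T, x = 0) : ∑ x ∈ T, x ^ 3 ≠ 0 := by
  intro h3
  obtain ⟨a, T, ha, rfl, hT'⟩ := Finset.card_eq_succ.1 hT
  obtain ⟨b, c, d, hbc, hbd, hcd, rfl⟩ := Finset.card_eq_three.1 hT'
  simp only [Finset.mem_insert, Finset.mem_singleton, not_or] at ha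
  simp [Finset.sum_insert, *] at h1 h3
  have := eq_of_sum_cubes_four (x₁ := a) (x₂ := b) (x₃ := c) (x₄ := d) (by grind) (by grind)
  grind

theorem snd_ne_zero_of_card_eq_four (hF : ∀ a b : F, a ^ 2 + a * b + b ^ 2 = 0 → a = 0 ∧ b = 0)
    {T : Finset F} (hT : T.card = 4) (h1 : ∑ x ∈ T, x = 0) :
    (∑ x ∈ T, teichmuller x).snd ≠ 0 := by
  intro h2
  obtain ⟨a, T, ha, rfl, hT'⟩ := Finset.card_eq_succ.1 hT
  obtain ⟨b, c, d, hbc, hbd, hcd, rfl⟩ := Finset.card_eq_three.1 hT'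
  simp only [Finset.mem_insert, Finset.mem_singleton, not_or] at ha
  simp [Finset.sum_insert, teichmuller, ha, hbc, hbd, hcd] at h1 h2
  refine ha.1 (eq_of_esymm_four hF (x₃ := c) (x₄ := d) ?_ ?_)
  · linear_combination h1
  · linear_combination h2

theorem not_disjoint_of_card_eq_three {P N : Finset F} (hP : P.card = 3) (hN : N.card = 3)
    (h1 : ∑ x ∈ P, x = ∑ x ∈ N, x)
    (h2 : (∑ x ∈ P, teichmuller x).snd = (∑ x ∈ N, teichmuller x).snd)
    (h3 : ∑ x ∈ P, x ^ 3 = ∑ x ∈ N, x ^ 3) : ¬ Disjoint P N := by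
  obtain ⟨a, b, c, hab, hac, hbc, rfl⟩ := Finset.card_eq_three.1 hP
  obtain ⟨a', b', c', hab', hac', hbc', rfl⟩ := Finset.card_eq_three.1 hN
  simp [Finset.sum_insert, teichmuller, *] at h1 h2 h3
  have := mem_of_sum_triple (x₁ := a) (x₂ := b) (x₃ := c) (y₁ := a') (y₂ := b') (y₃ := c')
    (by grind) (by grind) (by grind)
  simp
  grind

theorem sum_cubes_ne_of_card_eq_five
    (hF : ∀ a b : F, a ^ 2 + a * b + b ^ 2 = 0 → a = 0 ∧ b = 0) {P N : Finset F}
    (hP : P.card = 5) (hN : N.card = 1) (h1 : ∑ x ∈ P, x = ∑ x ∈ N, x)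
    (h2 : (∑ x ∈ P, teichmuller x).snd = (∑ x ∈ N, teichmuller x).snd) :
    ∑ x ∈ P, x ^ 3 ≠ ∑ x ∈ N, x ^ 3 := by
  intro h3
  obtain ⟨p, rfl⟩ := Finset.card_eq_one.1 hN
  obtain ⟨a, P, ha, rfl, hP'⟩ := Finset.card_eq_succ.1 hP
  obtain ⟨b, P, hb, rfl, hP''⟩ := Finset.card_eq_succ.1 hP'
  obtain ⟨c, d, e, hcd, hce, hde, rfl⟩ := Finset.card_eq_three.1 hP''
  simp only [Finset.mem_insert, Finset.mem_singleton, not_or] at ha hb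
  simp [Finset.sum_insert, teichmuller, ha, hb, hcd, hce, hde] at h1 h2 h3
  refine ha.1 (eq_of_sum_five hF (x₃ := c) (x₄ := d) (x₅ := e) (p := p) ha.2.2.2 hb.2.2 hce hde
    ?_ ?_ ?_)
  · linear_combination h1
  · linear_combination h2
  · linear_combination h3

variable [Fintype F]

/-- A relation of Lee weight at most seven between the vectors `(1, [x])` over `ℤ/4`, sorted by the
sets `P`, `N` and `B` of coefficients `1`, `-1` and `2`. The coefficients sum to zero modulo four,
and relations with at most two odd coefficients do not occur, which leaves four or six of them. -/
theorem relation_cases {w : F → ZMod 4} (hw : w ≠ 0) (hlee : ∑ x, leeWeight (w x) ≤ 7)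
    (h0 : ∑ x, (w x).val • (1 : ZMod 4) = 0)
    (h1 : ∑ x, (w x).val • teichmuller x = 0) :
    ∃ P N B : Finset F, Disjoint P N ∧ ∑ x, leeWeight (w x) = P.card + N.card + 2 * B.card ∧
      (∀ g : F → F, ∑ x, (w x).val • g x = 0 → ∑ x ∈ P, g x = ∑ x ∈ N, g x) ∧
      (B = ∅ → (∑ x ∈ P, teichmuller x).snd = (∑ x ∈ N, teichmuller x).snd) ∧
      ∑ x ∈ P, x = ∑ x ∈ N, x ∧
      (P.card + N.card = 4 ∧ (B = ∅ → Even P.card) ∨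
        P.card + N.card = 6 ∧ B = ∅ ∧ Odd P.card) := by
  obtain ⟨P, hP⟩ : ∃ P, P = Finset.univ.filter fun x => w x = 1 := ⟨_, rfl⟩
  obtain ⟨N, hN⟩ : ∃ N, N = Finset.univ.filter fun x => w x = 3 := ⟨_, rfl⟩
  obtain ⟨B, hB⟩ : ∃ B, B = Finset.univ.filter fun x => w x = 2 := ⟨_, rfl⟩
  have hd : Disjoint P N := by
    rw [hP, hN]
    exact Finset.disjoint_filter.2 fun _ _ h1 h2 => by simp [h1] at h2; revert h2; decide
  have hl := sum_leeWeight w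
  rw [sum_val_nsmul, ← hP, ← hN, ← hB] at h1
  rw [sum_val_nsmul, ← hP, ← hN, ← hB] at h0
  rw [← hP, ← hN, ← hB] at hl
  obtain ⟨e1, e2⟩ := sum_eq_of_relation h1
  have hmod : (P.card + 3 * N.card + 2 * B.card) % 4 = 0 := by
    rw [← Nat.dvd_iff_mod_eq_zero, ← ZMod.natCast_eq_zero_iff]
    simpa using h0
  have hpos : 0 < P.card + N.card + 2 * B.card := by
    obtain ⟨x, hx⟩ := Function.ne_iff.1 hw
    rw [← hl]
    refine Finset.sum_pos' (fun _ _ => Nat.zero_le _) ⟨x, Finset.mem_univ x, ?_⟩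
    have hpos : ∀ a : ZMod 4, a ≠ 0 → 0 < leeWeight a := by decide
    exact hpos _ hx
  have hPN : P.card + N.card ≠ 2 := by
    intro h
    refine sum_ne_zero_of_card_eq_two (T := P ∪ N) ?_ ?_
    · rw [Finset.card_union_of_disjoint hd, h]
    · rw [Finset.sum_union hd, e1, CharTwo.add_self_eq_zero]
  have h00 : P.card + N.card ≠ 0 := by
    intro h
    have hP0 : P = ∅ := Finset.card_eq_zero.1 (by omega)
    have hN0 : N = ∅ := Finset.card_eq_zero.1 (by omega)
    refine sum_ne_zero_of_card_eq_two (T := B) (by omega) ?_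
    rw [hP0, hN0] at e2
    exact pow_eq_zero_iff two_ne_zero |>.1 (by simpa using e2.symm)
  have hB0 : B = ∅ ↔ B.card = 0 := Finset.card_eq_zero.symm
  refine ⟨P, N, B, hd, hl, fun g hg => ?_, fun h => ?_, e1, ?_⟩
  · rw [sum_val_nsmul, ← hP, ← hN, ← hB] at hg
    have two : (2 : F) = 0 := CharTwo.two_eq_zero
    simp only [nsmul_eq_mul] at hg
    push_cast at hg
    grind
  · rw [h] at e2
    exact CharTwo.add_eq_zero.1 (by simpa using e2)
  · rw [hB0, Nat.even_iff, Nat.odd_iff]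
    omega

/-- The `ℤ/4`-linear Preparata code, the dual of the Kerdock code, has minimum Lee distance at least
six. -/
theorem preparata_lee (hF : ∀ a b : F, a ^ 2 + a * b + b ^ 2 = 0 → a = 0 ∧ b = 0)
    {w : F → ZMod 4} (hw : w ≠ 0) (hlee : ∑ x, leeWeight (w x) ≤ 5) :
    ∑ x, (w x).val • ((1 : ZMod 4), teichmuller x) ≠ 0 := by
  intro h
  obtain ⟨P, N, B, hd, hl, -, e2, e1, hc⟩ := relation_cases hw (by omega)
    (by simpa [Prod.fst_sum] using congrArg Prod.fst h)
    (by simpa [Prod.snd_sum] using congrArg Prod.snd h)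
  have hB : B = ∅ := Finset.card_eq_zero.1 (by omega)
  have e2 := e2 hB
  obtain ⟨h4, heven⟩ : P.card + N.card = 4 ∧ Even P.card := by
    rcases hc with h | h
    · exact ⟨h.1, h.2 hB⟩
    · omega
  rw [Nat.even_iff] at heven
  obtain h | h | h : N.card = 0 ∨ P.card = 0 ∨ P.card = 2 := by omega
  · rw [Finset.card_eq_zero.1 h] at e1 e2
    exact snd_ne_zero_of_card_eq_four hF (T := P) (by omega) (by simpa using e1) (by simpa using e2)
  · rw [Finset.card_eq_zero.1 h] at e1 e2
    exact snd_ne_zero_of_card_eq_four hF (T := N) (by omega) (by simpa using e1.symm)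
      (by simpa using e2.symm)
  · exact not_disjoint_of_card_eq_two h (by omega) e1 e2 hd

/-- The `ℤ/4`-linear Goethals code, the dual of a Delsarte–Goethals code, has minimum Lee distance
at least eight. -/
theorem goethals_lee (hF : ∀ a b : F, a ^ 2 + a * b + b ^ 2 = 0 → a = 0 ∧ b = 0)
    {w : F → ZMod 4} (hw : w ≠ 0) (hlee : ∑ x, leeWeight (w x) ≤ 7) :
    ∑ x, (w x).val • ((1 : ZMod 4), teichmuller x, x ^ 3) ≠ 0 := by
  intro h
  obtain ⟨P, N, B, hd, hl, hg, e2, e1, hc⟩ := relation_cases hw hlee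
    (by simpa [Prod.fst_sum] using congrArg Prod.fst h)
    (by simpa [Prod.fst_sum, Prod.snd_sum] using congrArg (fun a => a.2.1) h)
  have e3 := hg (fun x => x ^ 3) (by simpa [Prod.snd_sum] using congrArg (fun a => a.2.2) h)
  rcases hc with ⟨h4, -⟩ | ⟨h6, hB, hodd⟩
  · refine sum_cubes_ne_zero_of_card_eq_four (T := P ∪ N) ?_ ?_ ?_
    · rw [Finset.card_union_of_disjoint hd, h4]
    · rw [Finset.sum_union hd, e1, CharTwo.add_self_eq_zero]
    · rw [Finset.sum_union hd, e3, CharTwo.add_self_eq_zero]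
  · have e2 := e2 hB
    rw [Nat.odd_iff] at hodd
    obtain h | h | h : P.card = 5 ∨ P.card = 1 ∨ P.card = 3 := by omega
    · exact sum_cubes_ne_of_card_eq_five hF h (by omega) e1 e2 e3
    · exact sum_cubes_ne_of_card_eq_five hF (by omega) h e1.symm e2.symm e3.symm
    · exact not_disjoint_of_card_eq_three h (by omega) e1 e2 e3 hd

end Relations

theorem natCard_wittTwo (F : Type*) : Nat.card (WittTwo F) = Nat.card F ^ 2 := by
  rw [Nat.card_congr (WittTwo.equivProd F), Nat.card_prod, sq]

/-- The Gray image of the Kerdock code over the field with `2 ^ (n - 1)` elements. -/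
theorem existsOA_kerdock {n : ℕ} (hn : Even n) (hn4 : 4 ≤ n) :
    ExistsOA (2 ^ (2 * n)) (2 ^ n) 2 5 := by
  classical
  obtain ⟨m, rfl⟩ : ∃ m, n = m + 1 := ⟨n - 1, by omega⟩
  have hm : Odd m := by grind
  have hcard : Nat.card (GaloisField 2 m) = 2 ^ m := GaloisField.card 2 m (by omega)
  have h5 : 5 ≤ 2 * 2 ^ m := by
    have := Nat.pow_le_pow_right (n := 2) (by norm_num) (show 3 ≤ m by omega)
    omega
  have h := existsOA_gray (M := ZMod 4 × WittTwo (GaloisField 2 m)) (X := GaloisField 2 m)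
    (fun a => Prod.ext ((by decide : ∀ a : ZMod 4, 4 • a = 0) a.1)
      (WittTwo.four_nsmul_eq_zero a.2)) (s := 5) (by norm_num) (hcard.symm ▸ h5) _
    fun w hw hlee => preparata_lee (anisotropic_of_odd hm) hw hlee
  have e : 4 * (2 ^ m) ^ 2 = 2 ^ (2 * (m + 1)) := by ring
  have e' : 2 * 2 ^ m = 2 ^ (m + 1) := by ring
  simpa [natCard_wittTwo, hcard, e, e'] using h

/-- The columns of the Kerdock array are extended by the cubes `x ^ 3`. -/
theorem existsOA_delsarteGoethals {n : ℕ} (hn : Even n) (hn4 : 4 ≤ n) :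
    ExistsOA (2 ^ (3 * n - 1)) (2 ^ n) 2 7 := by
  classical
  obtain ⟨m, rfl⟩ : ∃ m, n = m + 1 := ⟨n - 1, by omega⟩
  have hm : Odd m := by grind
  have hcard : Nat.card (GaloisField 2 m) = 2 ^ m := GaloisField.card 2 m (by omega)
  have h7 : 7 ≤ 2 * 2 ^ m := by
    have := Nat.pow_le_pow_right (n := 2) (by norm_num) (show 3 ≤ m by omega)
    omega
  have h := existsOA_gray (M := ZMod 4 × WittTwo (GaloisField 2 m) × GaloisField 2 m)
    (X := GaloisField 2 m)
    (fun a => Prod.ext ((by decide : ∀ a : ZMod 4, 4 • a = 0) a.1)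
      (Prod.ext (WittTwo.four_nsmul_eq_zero a.2.1) (by
        have two : (2 : GaloisField 2 m) = 0 := CharTwo.two_eq_zero
        change 4 • a.2.2 = 0
        rw [nsmul_eq_mul]
        push_cast
        linear_combination 2 * a.2.2 * two)))
    (s := 7) (by norm_num) (hcard.symm ▸ h7) _
    fun w hw hlee => goethals_lee (anisotropic_of_odd hm) hw hlee
  have e : 4 * ((2 ^ m) ^ 2 * 2 ^ m) = 2 ^ (3 * (m + 1) - 1) := by
    rw [show 3 * (m + 1) - 1 = 3 * m + 2 by omega]
    ring
  have e' : 2 * 2 ^ m = 2 ^ (m + 1) := by ring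
  simpa [natCard_wittTwo, hcard, e, e'] using h

/-! ### Ternary caps -/

/-- Over `𝔽₃` three distinct points are collinear exactly when their sum is zero. -/
theorem isAffineCap_three {V ι : Type*} [AddCommGroup V] [Module (ZMod 3) V] {v : ι → V}
    (hv : Function.Injective v) (h : ∀ i j k, v i + v j + v k = 0 → i = j) :
    IsAffineCap (ZMod 3) v := by
  refine ⟨hv, fun t h0 h1 i j k hk => h i j k ?_⟩
  have ht : t = 2 := (by decide : ∀ t : ZMod 3, t ≠ 0 → t ≠ 1 → t = 2) t h0 h1
  have h3 : (3 : ZMod 3) = 0 := rfl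
  rw [hk, ht]
  have : v i + v j + (v i + (2 : ZMod 3) • (v j - v i)) = (3 : ZMod 3) • v j := by module
  rw [this, h3, zero_smul]

theorem IsAffineCap.existsOA_pow {d N : ℕ} {V ι : Type*} [AddCommGroup V] [Module (ZMod 3) V]
    [Finite V] [Finite ι] {v : ι → V} (hv : IsAffineCap (ZMod 3) v) (hV : Nat.card V = 3 ^ d)
    (hι : Nat.card ι = N) (hN : 3 ≤ N) {n : ℕ} (hn : 1 ≤ n) :
    ExistsOA (3 ^ (d * n + 1)) (N ^ n) 3 3 := by
  have h := (hv.pi n).existsOA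
  have e : 3 * (3 ^ d) ^ n = 3 ^ (d * n + 1) := by rw [pow_succ', pow_mul]
  simp only [Nat.card_fun, hV, hι, Nat.card_zmod, Nat.card_fin, e] at h
  exact h (hN.trans (Nat.le_self_pow (by omega) N))

/-- The nonzero singular vectors of the elliptic form `a ^ 2 + b ^ 2 + c * d` on `𝔽₃⁴`. As the form
has Witt index one, two of them with singular sum are opposite or equal. -/
def IsElliptic (x : ZMod 3 × ZMod 3 × ZMod 3 × ZMod 3) : Prop :=
  x ≠ 0 ∧ x.1 ^ 2 + x.2.1 ^ 2 + x.2.2.1 * x.2.2.2 = 0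

instance : DecidablePred IsElliptic := fun _ => inferInstanceAs (Decidable (_ ∧ _))

theorem natCard_isElliptic : Nat.card {x // IsElliptic x} = 20 := by
  rw [Nat.card_eq_fintype_card]
  decide +kernel

theorem isAffineCap_elliptic : IsAffineCap (ZMod 3) (fun x : {x // IsElliptic x} => x.1) := by
  refine isAffineCap_three Subtype.val_injective fun x y z h => Subtype.ext ?_
  have key : ∀ x, IsElliptic x → ∀ y, IsElliptic y → IsElliptic (-(x + y)) → x = y := by
    decide +kernel
  exact key x.1 x.2 y.1 y.2 (by rw [← eq_neg_of_add_eq_zero_right h]; exact z.2)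

/-- The ten blocks of a `2`-`(6, 3, 2)` design: five of them join the point `5` to the edges of a
pentagon on the remaining points. -/
def designBlocks : Finset (Finset (Fin 6)) :=
  {{0, 1, 5}, {1, 2, 5}, {2, 3, 5}, {3, 4, 5}, {4, 0, 5},
    {0, 1, 3}, {1, 2, 4}, {2, 3, 0}, {3, 4, 1}, {4, 0, 2}}

/-- The set of the nonzero coordinates. -/
def supp (x : Fin 6 → ZMod 3) : Finset (Fin 6) := Finset.univ.filter fun i => x i ≠ 0

/-- The vectors in `𝔽₃⁶` supported on a block of the design, and the vectors without zero
coordinates and with an even number of coordinates `-1`: up to sign, the points of the Hill cap. -/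
def IsHill (x : Fin 6 → ZMod 3) : Prop := supp x ∈ designBlocks ∨ ∏ i, x i = 1

instance : DecidablePred IsHill := fun _ => inferInstanceAs (Decidable (_ ∨ _))

theorem natCard_isHill : Nat.card {x // IsHill x} = 112 := by
  rw [Nat.card_eq_fintype_card]
  decide +kernel

theorem natCard_isHill_sum_eq_one : Nat.card {x // ∑ i, x i = 1 ∧ IsHill x} = 45 := by
  rw [Nat.card_eq_fintype_card]
  decide +kernel

theorem mem_supp {x : Fin 6 → ZMod 3} {i : Fin 6} : i ∈ supp x ↔ x i ≠ 0 := by simp [supp]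

theorem supp_eq_univ {x : Fin 6 → ZMod 3} (hx : ∏ i, x i = 1) : supp x = Finset.univ := by
  ext i
  simp only [mem_supp, Finset.mem_univ, iff_true]
  exact fun h => zero_ne_one ((Finset.prod_eq_zero (Finset.mem_univ i) h).symm.trans hx)

theorem supp_subset {x y z : Fin 6 → ZMod 3} (h : x + y + z = 0) : supp x ⊆ supp y ∪ supp z := by
  intro i
  simp only [Finset.mem_union, mem_supp]
  have := congrFun h i
  simp only [Pi.add_apply, Pi.zero_apply] at this
  grind

/-- Three sets among the blocks and the whole set, none of which has a point of its own, are equal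
or consist of a block and twice the whole set. -/
theorem designBlocks_triple : ∀ X ∈ insert Finset.univ designBlocks,
    ∀ Y ∈ insert Finset.univ designBlocks,
    ∀ Z ∈ insert Finset.univ designBlocks,
      X ⊆ Y ∪ Z → Y ⊆ X ∪ Z → Z ⊆ X ∪ Y → X = Y ∧ Y = Z ∨
        X ∈ designBlocks ∧ Y = Finset.univ ∧ Z = Finset.univ ∨
        Y ∈ designBlocks ∧ X = Finset.univ ∧ Z = Finset.univ ∨
        Z ∈ designBlocks ∧ X = Finset.univ ∧ Y = Finset.univ := by
  decide +kernel

/-- If two vectors without zero coordinates and a vector `x` sum to zero, then the two agree up to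
a sign which is `-1` at the three zeros of `x`. -/
theorem prod_ne_one_of_block {x y z : Fin 6 → ZMod 3} (h : x + y + z = 0)
    (hx : supp x ∈ designBlocks) (hy : ∏ i, y i = 1) : ∏ i, z i ≠ 1 := by
  intro hz
  have hsign : ∀ X ∈ designBlocks, ∏ i : Fin 6, (if i ∈ X then (1 : ZMod 3) else -1) = -1 := by
    decide +kernel
  have hi : ∀ i, z i = (if i ∈ supp x then 1 else -1) * y i := by
    intro i
    have h1 := congrFun h i
    have h2 : y i ≠ 0 := by rw [← mem_supp, supp_eq_univ hy]; exact Finset.mem_univ i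
    have h3 : z i ≠ 0 := by rw [← mem_supp, supp_eq_univ hz]; exact Finset.mem_univ i
    have key : ∀ a b c : ZMod 3, a + b + c = 0 → b ≠ 0 → c ≠ 0 →
        c = (if a ≠ 0 then 1 else -1) * b := by decide
    simp only [mem_supp]
    exact key _ _ _ h1 h2 h3
  rw [Finset.prod_congr rfl fun i _ => hi i, Finset.prod_mul_distrib, hsign _ hx, hy] at hz
  exact absurd hz (by decide)

theorem IsHill.eq_of_add_eq_zero {x y z : Fin 6 → ZMod 3} (hx : IsHill x) (hy : IsHill y)
    (hz : IsHill z) (h : x + y + z = 0) : x = y := by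
  have hmem : ∀ {x : Fin 6 → ZMod 3}, IsHill x → supp x ∈ insert Finset.univ designBlocks := by
    rintro x (h | h)
    · exact Finset.mem_insert_of_mem h
    · rw [supp_eq_univ h]
      exact Finset.mem_insert_self _ _
  have hprod : ∀ {x : Fin 6 → ZMod 3}, IsHill x → supp x = Finset.univ → ∏ i, x i = 1 := by
    rintro x (h | h) hu
    · rw [hu] at h
      exact absurd h (by decide)
    · exact h
  have h2 : y + x + z = 0 := by rw [← h]; abel
  have h3 : z + x + y = 0 := by rw [← h]; abel
  rcases designBlocks_triple _ (hmem hx) _ (hmem hy) _ (hmem hz) (supp_subset h)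
    (supp_subset h2) (supp_subset h3) with ⟨e1, e2⟩ | ⟨b, u, v⟩ | ⟨b, u, v⟩ | ⟨b, u, v⟩
  · ext i : 1
    have key : ∀ a b c : ZMod 3, a + b + c = 0 → (a ≠ 0 ↔ b ≠ 0) → (b ≠ 0 ↔ c ≠ 0) → a = b := by
      decide
    refine key _ _ _ (congrFun h i) ?_ ?_
    · rw [← mem_supp, ← mem_supp, e1]
    · rw [← mem_supp, ← mem_supp, e2]
  · exact absurd (hprod hz v) (prod_ne_one_of_block h b (hprod hy u))
  · exact absurd (hprod hz v) (prod_ne_one_of_block h2 b (hprod hx u))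
  · exact absurd (hprod hy v) (prod_ne_one_of_block h3 b (hprod hx u))

theorem isAffineCap_hill : IsAffineCap (ZMod 3) (fun x : {x // IsHill x} => x.1) :=
  isAffineCap_three Subtype.val_injective fun x y z h =>
    Subtype.ext (x.2.eq_of_add_eq_zero y.2 z.2 h)

/-- The section of the cap by the hyperplane `∑ i, x i = 1`, with the coordinates `0, …, 4` as
affine coordinates on the hyperplane. -/
theorem isAffineCap_hill_section :
    IsAffineCap (ZMod 3) (fun (x : {x // ∑ i, x i = 1 ∧ IsHill x}) (i : Fin 5) =>
      x.1 i.castSucc) := by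
  refine isAffineCap_three (fun x y h => Subtype.ext ?_) fun x y z h => Subtype.ext ?_
  · have h1 := x.2.1.trans y.2.1.symm
    rw [Fin.sum_univ_castSucc, Fin.sum_univ_castSucc (f := y.1),
      Finset.sum_congr rfl fun i _ => congrFun h i, add_right_inj] at h1
    exact funext fun i => Fin.lastCases h1 (fun i => congrFun h i) i
  · refine x.2.2.eq_of_add_eq_zero y.2.2 z.2.2 (funext fun i => ?_)
    refine Fin.lastCases ?_ (fun i => congrFun h i) i
    have hx := x.2.1
    have hy := y.2.1
    have hz := z.2.1
    rw [Fin.sum_univ_castSucc] at hx hy hz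
    have h0 : ∑ i : Fin 5, x.1 i.castSucc + ∑ i : Fin 5, y.1 i.castSucc +
        ∑ i : Fin 5, z.1 i.castSucc = 0 := by
      rw [← Finset.sum_add_distrib, ← Finset.sum_add_distrib]
      exact Finset.sum_eq_zero fun i _ => congrFun h i
    have h3 : (3 : ZMod 3) = 0 := rfl
    simp only [Pi.add_apply, Pi.zero_apply]
    linear_combination hx + hy + hz - h0 + h3

theorem existsOA_cap_twenty {n : ℕ} (hn : 1 ≤ n) : ExistsOA (3 ^ (4 * n + 1)) (20 ^ n) 3 3 :=
  isAffineCap_elliptic.existsOA_pow (by simp) natCard_isElliptic (by norm_num) hn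

theorem existsOA_cap_fortyFive {n : ℕ} (hn : 1 ≤ n) : ExistsOA (3 ^ (5 * n + 1)) (45 ^ n) 3 3 :=
  isAffineCap_hill_section.existsOA_pow (by simp) natCard_isHill_sum_eq_one
    (by norm_num) hn

theorem existsOA_cap_hundredTwelve {n : ℕ} (hn : 1 ≤ n) :
    ExistsOA (3 ^ (6 * n + 1)) (112 ^ n) 3 3 :=
  isAffineCap_hill.existsOA_pow (by simp) natCard_isHill (by norm_num) hn

/-! ### The order of growth of Rao's bound -/

open Filter Asymptotics

/-- Rao's bound has the order of growth of its last term. -/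
theorem isTheta_raoBound {q : ℕ} (hq : 2 ≤ q) (s : ℕ) :
    (fun C : ℕ => (raoBound C q s : ℝ)) =Θ[atTop] fun C : ℕ => (C : ℝ) ^ (s / 2) := by
  have hq1 : ((q : ℝ) - 1) ≠ 0 := by
    have : (2 : ℝ) ≤ q := by exact_mod_cast hq
    linarith
  have hcast : (fun C : ℕ => (raoBound C q s : ℝ)) = fun C : ℕ =>
      ∑ i ∈ Finset.range (s / 2 + 1), (C.choose i : ℝ) * ((q - 1 : ℕ) : ℝ) ^ i := by
    funext C
    simp [raoBound]
  have hq0 : ((q - 1 : ℕ) : ℝ) ≠ 0 := by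
    rw [Nat.cast_sub (by omega)]
    simpa using hq1
  have hterm : ∀ i, (fun C : ℕ => (C.choose i : ℝ) * ((q - 1 : ℕ) : ℝ) ^ i) =Θ[atTop]
      fun C : ℕ => (C : ℝ) ^ i := by
    intro i
    simp_rw [mul_comm _ (((q - 1 : ℕ) : ℝ) ^ i)]
    exact (isTheta_choose i).const_mul_left (pow_ne_zero i hq0)
  rw [hcast]
  refine ⟨?_, ?_⟩
  · refine IsBigO.fun_sum fun i hi => (hterm i).1.trans ?_
    refine IsBigO.of_bound (1 : ℝ) ?_
    filter_upwards [eventually_ge_atTop 1] with C hC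
    rw [Real.norm_of_nonneg (by positivity), Real.norm_of_nonneg (by positivity), one_mul]
    exact pow_le_pow_right₀ (by exact_mod_cast hC) (by have := Finset.mem_range.1 hi; omega)
  · refine (hterm (s / 2)).2.trans (IsBigO.of_bound 1 (Eventually.of_forall fun C => ?_))
    rw [Real.norm_of_nonneg (by positivity), Real.norm_of_nonneg (by positivity), one_mul]
    exact Finset.single_le_sum (f := fun i => (C.choose i : ℝ) * ((q - 1 : ℕ) : ℝ) ^ i)
      (fun i _ => by positivity) (Finset.self_mem_range_succ _)

theorem attainsRaoAsymptotically_iff {q s : ℕ} (hq : 2 ≤ q) {R C : ℕ → ℕ}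
    (hC : Tendsto C atTop atTop) :
    AttainsRaoAsymptotically R C q s ↔
      (fun k => (R k : ℝ)) =Θ[atTop] fun k => (C k : ℝ) ^ (s / 2) :=
  have h : (fun k => (raoBound (C k) q s : ℝ)) =Θ[atTop] fun k => (C k : ℝ) ^ (s / 2) :=
    ⟨(isTheta_raoBound hq s).1.comp_tendsto hC, (isTheta_raoBound hq s).2.comp_tendsto hC⟩
  ⟨fun h' => IsTheta.trans h' h, fun h' => IsTheta.trans h' h.symm⟩

theorem attainsRaoAsymptotically_of_le {q s : ℕ} (hq : 2 ≤ q) {R C : ℕ → ℕ}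
    (hC : Tendsto C atTop atTop) (a b : ℕ)
    (h : ∀ᶠ k in atTop, C k ^ (s / 2) ≤ a * R k ∧ R k ≤ b * C k ^ (s / 2)) :
    AttainsRaoAsymptotically R C q s := by
  rw [attainsRaoAsymptotically_iff hq hC]
  refine ⟨IsBigO.of_bound (b : ℝ) (h.mono fun k hk => ?_),
    IsBigO.of_bound (a : ℝ) (h.mono fun k hk => ?_)⟩
  · rw [Real.norm_of_nonneg (by positivity), Real.norm_of_nonneg (by positivity)]
    exact_mod_cast hk.2
  · rw [Real.norm_of_nonneg (by positivity), Real.norm_of_nonneg (by positivity)]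
    exact_mod_cast hk.1

/-- Arrays whose number of rows exceeds the order of growth of Rao's bound by an exponential factor
do not attain it. -/
theorem not_attainsRaoAsymptotically {q s : ℕ} (hq : 2 ≤ q) {R C : ℕ → ℕ}
    (hC : Tendsto C atTop atTop) {a c : ℝ} (ha : 1 < a) (hc : 0 < c)
    (h : ∀ k, (R k : ℝ) = c * a ^ k * (C k : ℝ) ^ (s / 2)) :
    ¬ AttainsRaoAsymptotically R C q s := by
  rw [attainsRaoAsymptotically_iff hq hC]
  intro hT
  obtain ⟨B, hB⟩ := hT.1.bound
  obtain ⟨k, hk1, hk2, hk3⟩ := (hB.and ((hC.eventually_ge_atTop 1).and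
    ((tendsto_pow_atTop_atTop_of_one_lt ha).eventually_gt_atTop (B / c)))).exists
  have hpos : (0 : ℝ) < (C k : ℝ) ^ (s / 2) := by
    have : (1 : ℝ) ≤ C k := by exact_mod_cast hk2
    positivity
  rw [Real.norm_of_nonneg (by positivity), Real.norm_of_nonneg hpos.le, h k] at hk1
  have h1 := le_of_mul_le_mul_right hk1 hpos
  rw [div_lt_iff₀ hc] at hk3
  linarith

theorem tendsto_pow_nat {b : ℕ} (hb : 2 ≤ b) : Tendsto (fun n => b ^ n) atTop atTop :=
  tendsto_pow_atTop_atTop_of_one_lt hb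

theorem tendsto_pow_mul_nat {b m : ℕ} (hb : 2 ≤ b) (hm : 1 ≤ m) :
    Tendsto (fun n => b ^ (m * n)) atTop atTop := by
  simp_rw [pow_mul]
  exact tendsto_pow_nat (hb.trans (Nat.le_self_pow (by omega) b))

/-! ### Exponents -/

theorem eq_mul_rpow_log (a b n : ℕ) (hb : 2 ≤ b) :
    ((3 ^ (a * n + 1) : ℕ) : ℝ) =
      3 * ((b ^ n : ℕ) : ℝ) ^ (a * Real.log 3 / Real.log b) := by
  have hb1 : (1 : ℝ) < b := by exact_mod_cast hb
  have hlog : Real.log b ≠ 0 := (Real.log_pos hb1).ne'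
  have h : ((b ^ n : ℕ) : ℝ) ^ (a * Real.log 3 / Real.log b) = (3 : ℝ) ^ (a * n) := by
    have h3 : (3 : ℝ) ^ (a * n) = Real.exp (Real.log 3 * ((a * n : ℕ) : ℝ)) := by
      rw [← Real.rpow_natCast, Real.rpow_def_of_pos (by norm_num)]
    rw [h3, Nat.cast_pow, Real.rpow_def_of_pos (by positivity), Real.log_pow]
    congr 1
    push_cast
    field_simp
  rw [h]
  push_cast
  ring

/-- Rational bounds for a logarithm to base `b`, from an inequality between natural numbers. -/
theorem div_le_mul_log_div_log {a b u v : ℕ} (hb : 2 ≤ b) (hv : 0 < v)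
    (h : b ^ u ≤ 3 ^ (a * v)) : (u / v : ℝ) ≤ a * Real.log 3 / Real.log b := by
  have hb1 : (1 : ℝ) < b := by exact_mod_cast hb
  rw [div_le_div_iff₀ (by positivity) (Real.log_pos hb1)]
  have h1 : Real.log ((b : ℝ) ^ u) ≤ Real.log ((3 : ℝ) ^ (a * v)) :=
    Real.log_le_log (by positivity) (by exact_mod_cast h)
  rw [Real.log_pow, Real.log_pow] at h1
  push_cast at h1
  linarith

theorem mul_log_div_log_le_div {a b u v : ℕ} (hb : 2 ≤ b) (hv : 0 < v)
    (h : 3 ^ (a * v) ≤ b ^ u) : a * Real.log 3 / Real.log b ≤ (u / v : ℝ) := by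
  have hb1 : (1 : ℝ) < b := by exact_mod_cast hb
  rw [div_le_div_iff₀ (Real.log_pos hb1) (by positivity)]
  have h1 : Real.log ((3 : ℝ) ^ (a * v)) ≤ Real.log ((b : ℝ) ^ u) :=
    Real.log_le_log (by positivity) (by exact_mod_cast h)
  rw [Real.log_pow, Real.log_pow] at h1
  push_cast at h1
  linarith

/-! ### The families of arrays -/

theorem tendsto_two_pow_sub_one : Tendsto (fun n => 2 ^ n - 1) atTop (atTop : Filter ℕ) :=
  tendsto_atTop_mono (fun n => Nat.le_sub_one_of_lt n.lt_two_pow_self) tendsto_id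

/-- The fractions `u / v` and `u' / v'` enclose the logarithm tightly enough and keep the powers to
be compared small. -/
theorem abs_log_ratio_sub_le {a b u v u' v' : ℕ} {t : ℝ} (hb : 2 ≤ b) (hv : 0 < v) (hv' : 0 < v')
    (h : b ^ u ≤ 3 ^ (a * v)) (h' : 3 ^ (a * v') ≤ b ^ u') (hu : t - 0.0005 ≤ u / v)
    (hu' : (u' / v' : ℝ) ≤ t + 0.0005) : |a * Real.log 3 / Real.log b - t| ≤ 0.0005 := by
  have h1 := div_le_mul_log_div_log hb hv h
  have h2 := mul_log_div_log_le_div hb hv' h'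
  rw [abs_le]
  constructor <;> linarith

set_option exponentiation.threshold 500 in
theorem abs_exponent_twenty_sub_le :
    |4 * Real.log 3 / Real.log 20 - 1.467| ≤ 0.0005 := by
  have h := abs_log_ratio_sub_le (a := 4) (b := 20) (u := 22) (v := 15) (u' := 135) (v' := 92)
    (t := 1.467) (by norm_num) (by norm_num) (by norm_num) (by norm_num) (by norm_num) (by norm_num)
    (by norm_num)
  exact_mod_cast h

set_option exponentiation.threshold 500 in
theorem abs_exponent_fortyFive_sub_le :
    |5 * Real.log 3 / Real.log 45 - 1.443| ≤ 0.0005 := by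
  have h := abs_log_ratio_sub_le (a := 5) (b := 45) (u := 88) (v := 61) (u' := 114) (v' := 79)
    (t := 1.443) (by norm_num) (by norm_num) (by norm_num) (by norm_num) (by norm_num) (by norm_num)
    (by norm_num)
  exact_mod_cast h

set_option exponentiation.threshold 500 in
theorem abs_exponent_hundredTwelve_sub_le :
    |6 * Real.log 3 / Real.log 112 - 1.397| ≤ 0.0005 := by
  have h := abs_log_ratio_sub_le (a := 6) (b := 112) (u := 81) (v := 58) (u' := 95) (v' := 68)
    (t := 1.397) (by norm_num) (by norm_num) (by norm_num) (by norm_num) (by norm_num) (by norm_num)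
    (by norm_num)
  exact_mod_cast h

/-- The number of rows exceeds the number of columns by the factor `3 * (3 ^ d / N) ^ n`. -/
theorem not_attainsRao_cap {d N : ℕ} (hN : 2 ≤ N) (h : N < 3 ^ d) :
    ¬ AttainsRaoAsymptotically (fun n => 3 ^ (d * n + 1)) (fun n => N ^ n) 3 3 := by
  have hN0 : (0 : ℝ) < N := by positivity
  refine not_attainsRaoAsymptotically (by norm_num) (tendsto_pow_nat hN)
    (a := (3 : ℝ) ^ d / N) (c := 3) ?_ (by norm_num) fun k => ?_
  · rw [lt_div_iff₀ hN0, one_mul]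
    exact_mod_cast h
  · rw [show 3 / 2 = 1 from rfl, pow_one, div_pow]
    push_cast
    field_simp
    ring

theorem theoremD2 :
    -- (1) strength 2
    (∀ q : ℕ, IsPrimePow q → ∀ n : ℕ, 2 ≤ n →
      ExistsOA (q ^ n) ((q ^ n - 1) / (q - 1)) q 2 ∧
      q ^ n = 1 + (q - 1) * ((q ^ n - 1) / (q - 1)) ∧
      q ^ n = raoBound ((q ^ n - 1) / (q - 1)) q 2) ∧
    -- (2) strength 3
    (∀ q : ℕ, IsPrimePow q →
      (∀ n : ℕ, 1 ≤ n →
        ExistsOA (q ^ (3 * n + 1)) (q ^ (2 * n)) q 3 ∧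
        ((q ^ (3 * n + 1) : ℕ) : ℝ) = (q : ℝ) * ((q ^ (2 * n) : ℕ) : ℝ) ^ (3 / 2 : ℝ)) ∧
      ¬ AttainsRaoAsymptotically (fun n => q ^ (3 * n + 1)) (fun n => q ^ (2 * n)) q 3) ∧
    -- (3a) binary, even strength
    (∀ s : ℕ, Even s → 2 ≤ s →
      (∀ n : ℕ, 1 ≤ n → s ≤ 2 ^ n - 1 →
        ExistsOA (2 ^ (n * (s / 2))) (2 ^ n - 1) 2 s ∧
        2 ^ (n * (s / 2)) = ((2 ^ n - 1) + 1) ^ (s / 2)) ∧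
      AttainsRaoAsymptotically (fun n => 2 ^ (n * (s / 2))) (fun n => 2 ^ n - 1) 2 s) ∧
    -- (3b) binary, odd strength
    (∀ s : ℕ, Odd s → 2 ≤ s →
      (∀ n : ℕ, 1 ≤ n → s ≤ 2 ^ n →
        ExistsOA (2 ^ (1 + n * (s / 2))) (2 ^ n) 2 s ∧
        2 ^ (1 + n * (s / 2)) = 2 * (2 ^ n) ^ (s / 2)) ∧
      AttainsRaoAsymptotically (fun n => 2 ^ (1 + n * (s / 2))) (fun n => 2 ^ n) 2 s) ∧
    -- (3c) binary, strength 5; the family runs over the even numbers `n = 2 k`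
    ((∀ n : ℕ, Even n → 4 ≤ n →
        ExistsOA (2 ^ (2 * n)) (2 ^ n) 2 5 ∧
        2 ^ (2 * n) = (2 ^ n) ^ (5 / 2 : ℕ)) ∧
      AttainsRaoAsymptotically (fun k => 2 ^ (2 * (2 * k))) (fun k => 2 ^ (2 * k)) 2 5) ∧
    -- (3d) binary, strength 7; the family runs over the even numbers `n = 2 k`
    ((∀ n : ℕ, Even n → 4 ≤ n →
        ExistsOA (2 ^ (3 * n - 1)) (2 ^ n) 2 7 ∧
        ((2 ^ (3 * n - 1) : ℕ) : ℝ) = 1 / 2 * ((2 ^ n : ℕ) : ℝ) ^ (7 / 2 : ℕ)) ∧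
      AttainsRaoAsymptotically (fun k => 2 ^ (3 * (2 * k) - 1)) (fun k => 2 ^ (2 * k)) 2 7) ∧
    -- (4a) ternary, strength 3
    ((∀ n : ℕ, 1 ≤ n →
        ExistsOA (3 ^ (4 * n + 1)) (20 ^ n) 3 3 ∧
        ((3 ^ (4 * n + 1) : ℕ) : ℝ) =
          3 * ((20 ^ n : ℕ) : ℝ) ^ (4 * Real.log 3 / Real.log 20)) ∧
      |4 * Real.log 3 / Real.log 20 - 1.467| ≤ 0.0005 ∧
      ¬ AttainsRaoAsymptotically (fun n => 3 ^ (4 * n + 1)) (fun n => 20 ^ n) 3 3) ∧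
    ((∀ n : ℕ, 1 ≤ n →
        ExistsOA (3 ^ (5 * n + 1)) (45 ^ n) 3 3 ∧
        ((3 ^ (5 * n + 1) : ℕ) : ℝ) =
          3 * ((45 ^ n : ℕ) : ℝ) ^ (5 * Real.log 3 / Real.log 45)) ∧
      |5 * Real.log 3 / Real.log 45 - 1.443| ≤ 0.0005 ∧
      ¬ AttainsRaoAsymptotically (fun n => 3 ^ (5 * n + 1)) (fun n => 45 ^ n) 3 3) ∧
    ((∀ n : ℕ, 1 ≤ n →
        ExistsOA (3 ^ (6 * n + 1)) (112 ^ n) 3 3 ∧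
        ((3 ^ (6 * n + 1) : ℕ) : ℝ) =
          3 * ((112 ^ n : ℕ) : ℝ) ^ (6 * Real.log 3 / Real.log 112)) ∧
      |6 * Real.log 3 / Real.log 112 - 1.397| ≤ 0.0005 ∧
      ¬ AttainsRaoAsymptotically (fun n => 3 ^ (6 * n + 1)) (fun n => 112 ^ n) 3 3) ∧
    -- (4b) ternary, strength 4
    ((∀ n : ℕ, 2 ≤ n →
        ExistsOA (3 ^ (2 * n + 1)) (3 ^ n) 3 4 ∧
        3 ^ (2 * n + 1) = 3 * (3 ^ n) ^ 2) ∧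
      AttainsRaoAsymptotically (fun n => 3 ^ (2 * n + 1)) (fun n => 3 ^ n) 3 4) ∧
    -- (5) general strength
    (∀ q : ℕ, q.Prime → ∀ s : ℕ, 2 ≤ s →
      (∀ n : ℕ, 1 ≤ n → s ≤ q ^ n →
        ExistsOA (q ^ (n * s)) (q ^ n) q s ∧
        q ^ (n * s) = (q ^ n) ^ s) ∧
      ¬ AttainsRaoAsymptotically (fun n => q ^ (n * s)) (fun n => q ^ n) q s) := by
  refine ⟨?_, ?_, ?_, ?_, ?_, ?_, ?_, ?_, ?_, ?_, ?_⟩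
  · intro q hq n hn
    have hq2 : 2 ≤ q := hq.two_le
    have hdvd : q - 1 ∣ q ^ n - 1 := by simpa using Nat.sub_dvd_pow_sub_pow q 1 n
    have hR : q ^ n = 1 + (q - 1) * ((q ^ n - 1) / (q - 1)) := by
      rw [Nat.mul_div_cancel' hdvd]
      have : 0 < q ^ n := by positivity
      omega
    refine ⟨?_, hR, ?_⟩
    · obtain ⟨p, k, hp, hk, rfl⟩ := (isPrimePow_nat_iff q).1 hq
      have := Fact.mk hp
      have h := existsOA_two (GaloisField p k) hn
      rwa [GaloisField.card p k hk.ne'] at h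
    · rw [raoBound, show 2 / 2 + 1 = 2 from rfl, Finset.sum_range_succ, Finset.sum_range_one]
      simp only [Nat.choose_zero_right, Nat.choose_one_right, pow_zero, pow_one, mul_one]
      rw [mul_comm ((q ^ n - 1) / (q - 1))]
      exact hR
  · intro q hq
    have hq2 : 2 ≤ q := hq.two_le
    refine ⟨fun n hn => ⟨?_, ?_⟩, ?_⟩
    · obtain ⟨p, k, hp, hk, rfl⟩ := (isPrimePow_nat_iff q).1 hq
      have := Fact.mk hp
      have h := existsOA_three (GaloisField p k) hn
      rwa [GaloisField.card p k hk.ne'] at h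
    · have h : ((q ^ (2 * n) : ℕ) : ℝ) = (q : ℝ) ^ (((2 * n : ℕ)) : ℝ) := by
        rw [Real.rpow_natCast]
        push_cast
        rfl
      rw [h, ← Real.rpow_mul (Nat.cast_nonneg q),
        show ((2 * n : ℕ) : ℝ) * (3 / 2) = ((3 * n : ℕ) : ℝ) by push_cast; ring, Real.rpow_natCast]
      push_cast
      ring
    · refine not_attainsRaoAsymptotically hq2 (tendsto_pow_mul_nat hq2 (by norm_num))
        (a := q) (c := q) (by exact_mod_cast hq2) (by positivity) fun k => ?_
      rw [show 3 / 2 = 1 from rfl, pow_one]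
      push_cast
      ring
  · rintro s hs h2s
    obtain ⟨t, rfl⟩ := hs.two_dvd
    rw [Nat.mul_div_cancel_left t two_pos]
    have hR : ∀ n, 2 ^ (n * t) = ((2 ^ n - 1) + 1) ^ t := fun n => by
      rw [Nat.sub_add_cancel Nat.one_le_two_pow, pow_mul]
    refine ⟨fun n hn hsn => ⟨existsOA_bch_even (by omega) hn hsn, hR n⟩, ?_⟩
    refine attainsRaoAsymptotically_of_le le_rfl tendsto_two_pow_sub_one 1 (2 ^ t) ?_
    filter_upwards [eventually_ge_atTop 1] with n hn
    have h1 : 2 ^ 1 ≤ 2 ^ n := Nat.pow_le_pow_right two_pos hn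
    rw [Nat.mul_div_cancel_left t two_pos, hR, ← mul_pow, one_mul]
    exact ⟨Nat.pow_le_pow_left (by omega) t, Nat.pow_le_pow_left (by omega) t⟩
  · rintro s ⟨t, rfl⟩ h2s
    have ht : (2 * t + 1) / 2 = t := by omega
    have hR : ∀ n, 2 ^ (1 + n * t) = 2 * (2 ^ n) ^ t := fun n => by rw [pow_add, pow_mul, pow_one]
    simp only [ht]
    refine ⟨fun n hn hsn => ⟨existsOA_bch_odd (by omega) hn hsn, hR n⟩, ?_⟩
    refine attainsRaoAsymptotically_of_le le_rfl (tendsto_pow_nat le_rfl) 1 2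
      (Eventually.of_forall fun n => ?_)
    simp only [ht, hR]
    omega
  · have hR : ∀ n, 2 ^ (2 * n) = (2 ^ n) ^ (5 / 2 : ℕ) := fun n => by rw [mul_comm, pow_mul]
    refine ⟨fun n hn h4 => ⟨existsOA_kerdock hn h4, hR n⟩, ?_⟩
    refine attainsRaoAsymptotically_of_le le_rfl (tendsto_pow_mul_nat le_rfl (by norm_num)) 1 1
      (Eventually.of_forall fun n => ?_)
    simp only [hR]
    omega
  · have hR : ∀ n, 1 ≤ n → (2 ^ n) ^ (7 / 2 : ℕ) = 2 * 2 ^ (3 * n - 1) := fun n hn => by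
      rw [← pow_succ', ← pow_mul]
      congr 1
      omega
    refine ⟨fun n hn h4 => ⟨existsOA_delsarteGoethals hn h4, ?_⟩, ?_⟩
    · have h : (((2 ^ n) ^ (7 / 2 : ℕ) : ℕ) : ℝ) = ((2 * 2 ^ (3 * n - 1) : ℕ) : ℝ) := by
        rw [hR n (by omega)]
      rw [← Nat.cast_pow, h]
      push_cast
      ring
    · refine attainsRaoAsymptotically_of_le le_rfl (tendsto_pow_mul_nat le_rfl (by norm_num)) 2 1 ?_
      filter_upwards [eventually_ge_atTop 1] with k hk
      rw [hR _ (by omega)]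
      omega
  · exact ⟨fun n hn => ⟨existsOA_cap_twenty hn,
      by exact_mod_cast eq_mul_rpow_log 4 20 n (by norm_num)⟩,
      abs_exponent_twenty_sub_le,
      not_attainsRao_cap (by norm_num) (by norm_num)⟩
  · exact ⟨fun n hn => ⟨existsOA_cap_fortyFive hn,
      by exact_mod_cast eq_mul_rpow_log 5 45 n (by norm_num)⟩,
      abs_exponent_fortyFive_sub_le,
      not_attainsRao_cap (by norm_num) (by norm_num)⟩
  · exact ⟨fun n hn => ⟨existsOA_cap_hundredTwelve hn,
      by exact_mod_cast eq_mul_rpow_log 6 112 n (by norm_num)⟩,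
      abs_exponent_hundredTwelve_sub_le,
      not_attainsRao_cap (by norm_num) (by norm_num)⟩
  · have hR : ∀ n, 3 ^ (2 * n + 1) = 3 * (3 ^ n) ^ 2 := fun n => by ring
    refine ⟨fun n hn => ⟨existsOA_three_four hn, hR n⟩, ?_⟩
    refine attainsRaoAsymptotically_of_le (by norm_num) (tendsto_pow_nat (by norm_num)) 1 3
      (Eventually.of_forall fun n => ?_)
    simp only [hR, show 4 / 2 = 2 from rfl]
    omega
  · intro q hq s hs
    have := Fact.mk hq
    refine ⟨fun n hn hsn => ⟨existsOA_reedSolomon hs hn hsn, pow_mul q n s⟩, ?_⟩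
    refine not_attainsRaoAsymptotically hq.two_le (tendsto_pow_nat hq.two_le)
      (a := (q : ℝ) ^ (s - s / 2)) (c := 1) ?_ one_pos fun k => ?_
    · exact one_lt_pow₀ (by exact_mod_cast hq.one_lt) (by omega)
    · push_cast
      rw [one_mul, ← pow_mul, ← pow_mul, ← pow_add, mul_comm (s - s / 2), ← mul_add]
      congr 2
      omega
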